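/- Let $D,S\ge 0$ be integers, $\mathcal X=\{1,\dots,S\}^D$, and let $\alpha:[0,1)\to(-\infty,1)$ be a differentiable nondecreasing noise schedule (e.g. $\alpha_t=t$), with derivative $\dot\alpha_t$. For $t\in[0,1)$, $x\in\mathcal X$ and $d\in\{1,\dots,D\}$ let a planner $p_\theta(z_t^d=N\mid x)\in[0,1]$ and a denoiser $p^\theta_{1|t}(x_1^d=\cdot\mid x,z_t^d=N)$, a probability distribution on $\{1,\dots,S\}$, be given, both measurable in $t$. Put $$\tilde R_t(x,j^d)=\frac{\dot\alpha_t}{1-\alpha_t}\,p_\theta(z_t^d=N\mid x)\,p^\theta_{1|t}(x_1^d=j^d\mid x,z_t^d=N)\qquad\text{for all }x,\ d,\ j^d .$$ Consider the following two processes on $[0,1)$, started from the same (arbitrary) initial distribution on $\mathcal X$. (a) The original process: the time-inhomogeneous continuous-time Markov chain on $\mathcal X$ whose rate matrix has off-diagonal entries as follows: from $x$, the value $x^d$ changes to $j^d\neq x^d$ (all other dimensions being kept) at rate $R_{t,\mathrm{jump}}(x,j^d)=\tilde R_t(x,j^d)$; all other off-diagonal entries are $0$, and the rows sum to $0$. That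 is, the chain stays in $x$ for a waiting time with (time-dependent) exponential rate $\sum_d\sum_{j^d\ne x^d}R_{t,\mathrm{jump}}(x,j^d)$ and then moves to a different state with probability proportional to the rates at the time of the jump. (b) The self-loop process: in state $x$, wait for a time with (time-dependent) exponential rate $\sum_{d,j^d}\tilde R_t(x,j^d)$, the sum now including $j^d=x^d$; at the end $t$ of the waiting time, choose a pair $(\bar d,j^{\bar d})$ with probability $\tilde R_t(x,j^{\bar d})/\sum_{d,j^d}\tilde R_t(x,j^d)$ and set $x^{\bar d}$ to $j^{\bar d}$ (so that the state may stay the same); repeat. Then the two processes have the same distribution over trajectories $[0,1)\to\mathcal X$. Moreover, for all $t\in[0,1)$ and $x\in\mathcal X$, the total jump rate of the self-loop process is $$\sum_{d,j^d}\tilde R_t(x,j^d)=\frac{\dot\alpha_t}{1-\alpha_t}\sum_d p_\theta(z_t^d=N\mid x),$$ and, if it is nonzero, then at a jump from $x$ at time $t$ the dimension $\bar d$ equals $d$ with probability $p_\theta(z_t^d=N\mid x)/\sum_{d'}p_\theta(z_t^{d'}=N\mid x)$, and, conditionally on $\bar d=d$ (for every $d$ of positive probability), the new value $j^d$ has the distribution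 $p^\theta_{1|t}(x_1^d=\cdot\mid x,z_t^d=N)$. -/

import Mathlib

open MeasureTheory ProbabilityTheory Set
open scoped NNReal ENNReal

noncomputable section

/-- A (time-inhomogeneous) jump mechanism on the states `X` during the time interval `[0, 1)`:
in state `x` at time `t`, the event `e` fires with rate `rate t x e`, and then moves the state
to `act x e`. Events with `act x e = x` (self-loops) are allowed. -/
structure JumpMechanism (X E : Type*) where
  rate : ℝ → X → E → ℝ≥0
  measurable_rate : ∀ x e, Measurable fun t => rate t x e
  act : X → E → X

namespace JumpMechanism

section Basic

variable {X E : Type*} [Fintype E] (J : JumpMechanism X E)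

/-- The total jump rate in state `x` at time `t`. -/
def total (t : ℝ) (x : X) : ℝ≥0 := ∑ e, J.rate t x e

/-- The probability that a jump occurring in state `x` at time `t` is caused by the event `e`. -/
def eventProb (t : ℝ) (x : X) (e : E) : ℝ≥0 := J.rate t x e / J.total t x

/-- The integrated total jump rate of the state `x` over the time interval `(s, t)`. -/
def cumRate (x : X) (s t : ℝ) : ℝ≥0∞ := ∫⁻ u in Ioo s t, (J.total u x : ℝ≥0∞)

/-- The time of the next jump, when the state is `p.2` since time `p.1` and `ξ` is the value of a
standard exponential variable: the first time at which the integrated total jump rate reaches `ξ`.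
If this does not happen before time `1`, the value is `1`. For a standard exponential `ξ`, the
probability that the jump time exceeds `t < 1` is `exp (- ∫ total)`, the integral being over
`(p.1, t)`, i.e. the waiting time is exponential with (time-dependent) rate `total`. -/
def nextTime (p : ℝ × X) (ξ : ℝ) : ℝ :=
  sInf ({t | t ∈ Ioo p.1 1 ∧ ENNReal.ofReal ξ ≤ J.cumRate p.2 p.1 t} ∪ {1})

lemma measurable_total (x : X) : Measurable fun t => J.total t x := by
  unfold total
  exact Finset.measurable_sum _ fun e _ => J.measurable_rate x e

lemma cumRate_mono (x : X) (s : ℝ) : Monotone (J.cumRate x s) := by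
  intro a b hab
  exact lintegral_mono_set (Ioo_subset_Ioo_right hab)

lemma measurable_cumRate (x : X) (t : ℝ) : Measurable fun s => J.cumRate x s t := by
  have h : ∀ s, J.cumRate x s t
      = ∫⁻ u, {q : ℝ × ℝ | q.1 < q.2 ∧ q.2 < t}.indicator
          (fun q => (J.total q.2 x : ℝ≥0∞)) (s, u) := by
    intro s
    rw [cumRate, ← lintegral_indicator measurableSet_Ioo]
    rfl
  simp_rw [h]
  refine Measurable.lintegral_prod_right' (f := {q : ℝ × ℝ | q.1 < q.2 ∧ q.2 < t}.indicator
      (fun q => (J.total q.2 x : ℝ≥0∞))) ?_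
  refine Measurable.indicator ?_ ?_
  · exact ((J.measurable_total x).comp measurable_snd).coe_nnreal_ennreal
  · exact (measurableSet_lt measurable_fst measurable_snd).inter
      (measurableSet_lt measurable_snd measurable_const)

lemma nextTime_lt_iff (p : ℝ × X) (ξ c : ℝ) : J.nextTime p ξ < c ↔
    1 < c ∨ ∃ q : ℚ, (q : ℝ) < c ∧ (p.1 < q ∧ (q : ℝ) < 1) ∧
      ENNReal.ofReal ξ ≤ J.cumRate p.2 p.1 q := by
  have hb : BddBelow ({t | t ∈ Ioo p.1 1 ∧ ENNReal.ofReal ξ ≤ J.cumRate p.2 p.1 t} ∪ {1}) := by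
    refine ⟨min p.1 1, ?_⟩
    rintro t (ht | rfl)
    · exact (min_le_left _ _).trans ht.1.1.le
    · exact min_le_right _ _
  rw [nextTime, csInf_lt_iff hb ⟨1, Or.inr rfl⟩]
  constructor
  · rintro ⟨t, (ht | rfl), htc⟩
    · right
      obtain ⟨q, hq1, hq2⟩ := exists_rat_btwn (lt_min htc ht.1.2)
      exact ⟨q, hq2.trans_le (min_le_left _ _), ⟨ht.1.1.trans hq1,
        hq2.trans_le (min_le_right _ _)⟩, ht.2.trans (J.cumRate_mono _ _ hq1.le)⟩
    · exact Or.inl htc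
  · rintro (h | ⟨q, hq, hq', hq''⟩)
    · exact ⟨1, Or.inr rfl, h⟩
    · exact ⟨q, Or.inl ⟨hq', hq''⟩, hq⟩

end Basic

section Law

variable {X E : Type*} [Fintype X] [MeasurableSpace X] [DiscreteMeasurableSpace X]
  [Fintype E] (J : JumpMechanism X E)

lemma measurable_nextTime : Measurable fun a : (ℝ × X) × ℝ => J.nextTime a.1 a.2 := by
  refine measurable_of_Iio fun c => ?_
  have hc : ∀ q : ℚ, Measurable fun p : ℝ × X => J.cumRate p.2 p.1 q := fun q =>
    measurable_from_prod_countable_left fun x => J.measurable_cumRate x q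
  have h : (fun a : (ℝ × X) × ℝ => J.nextTime a.1 a.2) ⁻¹' Iio c
      = {_a | 1 < c} ∪ ⋃ q : ℚ, {a : (ℝ × X) × ℝ | (q : ℝ) < c ∧ (a.1.1 < q ∧ (q : ℝ) < 1) ∧
          ENNReal.ofReal a.2 ≤ J.cumRate a.1.2 a.1.1 q} := by
    ext a
    simp only [mem_preimage, mem_Iio, nextTime_lt_iff, mem_union, mem_ofPred_eq, mem_iUnion]
  rw [h]
  refine (MeasurableSet.const _).union (MeasurableSet.iUnion fun q => ?_)
  refine (MeasurableSet.const _).inter (MeasurableSet.inter (MeasurableSet.inter ?_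
    (MeasurableSet.const _)) ?_)
  · exact measurableSet_lt (measurable_fst.comp measurable_fst) measurable_const
  · exact measurableSet_le (ENNReal.measurable_ofReal.comp measurable_snd)
      ((hc q).comp measurable_fst)

/-- The law of the next jump time, given the time of the last jump and the current state. -/
def timeKernel : Kernel (ℝ × X) ℝ :=
  (Kernel.prod Kernel.id (Kernel.const _ (expMeasure 1))).map fun a => J.nextTime a.1 a.2

instance : IsProbabilityMeasure (expMeasure 1) := isProbabilityMeasure_expMeasure one_pos

instance : IsMarkovKernel J.timeKernel :=
  Kernel.IsMarkovKernel.map _ J.measurable_nextTime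

/-- The law of the state after a jump at time `t` from state `x`: the event is sampled with
probability proportional to its rate. (If there is no jump in `[0, 1)`, which is encoded by a jump
time `t ≥ 1`, or if the total rate vanishes, then the state stays the same.) -/
def nextLaw (t : ℝ) (x : X) : Measure X :=
  open Classical in
  if t < 1 ∧ J.total t x ≠ 0 then
    ∑ e, (J.eventProb t x e : ℝ≥0∞) • Measure.dirac (J.act x e)
  else Measure.dirac x

lemma measurable_nextLaw : Measurable fun a : (ℝ × X) × ℝ => J.nextLaw a.2 a.1.2 := by
  classical
  have h : Measurable fun b : ℝ × X => J.nextLaw b.1 b.2 := by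
    refine measurable_from_prod_countable_left fun x => ?_
    change Measurable fun t => J.nextLaw t x
    unfold nextLaw
    refine Measurable.ite ?_ ?_ measurable_const
    · exact measurableSet_Iio.inter
        ((J.measurable_total x) (MeasurableSet.singleton 0).compl)
    · refine Measure.measurable_of_measurable_coe _ fun s _ => ?_
      simp only [Measure.coe_finsetSum, Finset.sum_apply, Measure.smul_apply, smul_eq_mul]
      refine Finset.measurable_sum _ fun e _ => ?_
      exact ((J.measurable_rate x e).div
        (J.measurable_total x)).coe_nnreal_ennreal.mul_const _
  exact h.comp (measurable_snd.prodMk (measurable_snd.comp measurable_fst))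

/-- The law of the state after the next jump, given the time of the last jump, the current state,
and the time of the next jump. -/
def stateKernel : Kernel ((ℝ × X) × ℝ) X where
  toFun a := J.nextLaw a.2 a.1.2
  measurable' := J.measurable_nextLaw

instance : IsMarkovKernel J.stateKernel := by
  classical
  refine ⟨fun a => ⟨?_⟩⟩
  change J.nextLaw a.2 a.1.2 univ = 1
  unfold nextLaw
  split_ifs with h
  · simp only [Measure.coe_finsetSum, Finset.sum_apply, Measure.smul_apply, smul_eq_mul,
      measure_univ, mul_one, eventProb]
    rw [← ENNReal.ofNNReal_finsetSum, ← Finset.sum_div]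
    exact_mod_cast div_self h.2
  · simp

/-- One round of the simulation: sample the next jump time, then the next state. -/
def step : Kernel (ℝ × X) (ℝ × X) := J.timeKernel ⊗ₖ J.stateKernel

instance : IsMarkovKernel J.step := by unfold step; infer_instance

/-- The kernel for the `(n + 1)`-st jump, given the history of the first `n` jumps. -/
def historyKernel (n : ℕ) : Kernel ((i : Finset.Iic n) → ℝ × X) (ℝ × X) :=
  J.step.comap (fun h => h ⟨n, Finset.mem_Iic.2 le_rfl⟩) (measurable_pi_apply _)

instance (n : ℕ) : IsMarkovKernel (J.historyKernel n) := by
  unfold historyKernel; infer_instance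

/-- The law of the sequence of (jump time, state after that jump), started at time `0` from the
initial distribution `p₀`, obtained by repeating the rounds of the simulation. -/
def chainLaw (p₀ : PMF X) : Measure (ℕ → ℝ × X) :=
  Kernel.trajMeasure (X := fun _ => ℝ × X) (p₀.toMeasure.map fun x => ((0 : ℝ), x))
    J.historyKernel

instance (p₀ : PMF X) : IsProbabilityMeasure (J.chainLaw p₀) := by
  have : IsProbabilityMeasure (p₀.toMeasure.map fun x => ((0 : ℝ), x)) :=
    Measure.isProbabilityMeasure_map (by fun_prop)
  unfold chainLaw; infer_instance

end Law

end JumpMechanism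

section Path

variable {X : Type*}

/-- The number of jumps up to and including time `t`, of a chain of (jump time, state). -/
def jumpCount (h : ℕ → ℝ × X) (t : ℝ) : ℕ := sInf {n | t < (h (n + 1)).1}

/-- The trajectory over `[0, 1)` of a chain of (jump time, state): the right-continuous path that
stays in each state until the next jump time. -/
def pathOf (h : ℕ → ℝ × X) (t : Ico (0 : ℝ) 1) : X := (h (jumpCount h t)).2

variable [MeasurableSpace X]

lemma measurable_jumpCount (t : ℝ) : Measurable fun h : ℕ → ℝ × X => jumpCount h t := by
  classical
  have hm : ∀ n : ℕ, MeasurableSet {h : ℕ → ℝ × X | t < (h (n + 1)).1} := fun n =>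
    measurableSet_lt measurable_const (measurable_fst.comp (measurable_pi_apply _))
  refine measurable_of_Iio fun c => ?_
  have h : (fun h : ℕ → ℝ × X => jumpCount h t) ⁻¹' Iio c
      = (⋃ n ∈ Iio c, {h : ℕ → ℝ × X | t < (h (n + 1)).1})
        ∪ ({_h | 0 < c} ∩ ⋂ n, {h : ℕ → ℝ × X | t < (h (n + 1)).1}ᶜ) := by
    ext h
    simp only [mem_preimage, mem_Iio, mem_union, mem_iUnion, mem_ofPred_eq, mem_inter_iff,
      mem_iInter, mem_compl_iff, exists_prop]
    constructor
    · intro hc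
      rcases ({n | t < (h (n + 1)).1} : Set ℕ).eq_empty_or_nonempty with he | hne
      · right
        exact ⟨(Nat.zero_le _).trans_lt hc, fun n hn => by
          have : n ∈ ({n | t < (h (n + 1)).1} : Set ℕ) := hn
          rw [he] at this
          exact this⟩
      · exact Or.inl ⟨_, hc, Nat.sInf_mem hne⟩
    · rintro (⟨n, hn, hn'⟩ | ⟨hc, hn⟩)
      · exact (Nat.sInf_le hn').trans_lt hn
      · have he : ({n | t < (h (n + 1)).1} : Set ℕ) = ∅ := by
          ext n; simpa using hn n
        rw [jumpCount, he, Nat.sInf_empty]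
        exact hc
  rw [h]
  exact (MeasurableSet.biUnion (to_countable _) fun n _ => hm n).union
    ((MeasurableSet.const _).inter (MeasurableSet.iInter fun n => (hm n).compl))

lemma measurable_pathOf : Measurable (pathOf : (ℕ → ℝ × X) → Ico (0 : ℝ) 1 → X) := by
  refine measurable_pi_lambda _ fun t => ?_
  have h : Measurable fun q : (ℕ → ℝ × X) × ℕ => (q.1 q.2).2 :=
    measurable_from_prod_countable_left fun n => measurable_snd.comp (measurable_pi_apply n)
  exact h.comp (measurable_id.prodMk (measurable_jumpCount (t : ℝ)))

end Path

namespace JumpMechanism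

variable {X E : Type*} [Fintype X] [MeasurableSpace X] [DiscreteMeasurableSpace X]
  [Fintype E] (J : JumpMechanism X E)

/-- The distribution over trajectories `[0, 1) → X` of the simulated process. -/
def trajectoryLaw (p₀ : PMF X) : Measure (Ico (0 : ℝ) 1 → X) := (J.chainLaw p₀).map pathOf

instance (p₀ : PMF X) : IsProbabilityMeasure (J.trajectoryLaw p₀) :=
  Measure.isProbabilityMeasure_map measurable_pathOf.aemeasurable

end JumpMechanism

/-- The jump mechanism of a continuous-time Markov chain with rate matrices `Q t`: in state `x`, a
jump happens at total rate `∑ y ≠ x, Q t x y` (which is `- Q t x x` if the rows sum to zero), and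
the next state is `y ≠ x` with probability proportional to `Q t x y`. There are no self-loops. -/
def ctmcMechanism {X : Type*} [DecidableEq X] (Q : ℝ → Matrix X X ℝ)
    (hQ : ∀ x y, Measurable fun t => Q t x y) : JumpMechanism X X where
  rate t x y := if y = x then 0 else (Q t x y).toNNReal
  measurable_rate x y := by
    by_cases h : y = x
    · simp [h]
    · simpa [h] using (hQ x y).real_toNNReal
  act _ y := y

/-- A planner and a denoiser for sequences in `{1, …, S} ^ D`, with a noise schedule `α`.
`planner t x d` is the probability that dimension `d` of the sequence `x` at time `t` is noise;
`denoiser t x d j` is the probability that the clean value of dimension `d` is `j`, given the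
sequence `x` at time `t` and given that dimension `d` of it is noise. -/
structure PlannerDenoiser (D S : ℕ) where
  α : ℝ → ℝ
  differentiableOn_α : DifferentiableOn ℝ α (Ico 0 1)
  monotoneOn_α : MonotoneOn α (Ico 0 1)
  α_lt_one : ∀ t ∈ Ico (0 : ℝ) 1, α t < 1
  planner : ℝ → (Fin D → Fin S) → Fin D → ℝ
  planner_mem : ∀ t x d, planner t x d ∈ Icc (0 : ℝ) 1
  measurable_planner : ∀ x d, Measurable fun t => planner t x d
  denoiser : ℝ → (Fin D → Fin S) → Fin D → Fin S → ℝ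
  denoiser_nonneg : ∀ t x d j, 0 ≤ denoiser t x d j
  sum_denoiser : ∀ t x d, ∑ j, denoiser t x d j = 1
  measurable_denoiser : ∀ x d j, Measurable fun t => denoiser t x d j

namespace PlannerDenoiser

variable {D S : ℕ} (M : PlannerDenoiser D S)

/-- The noise removal rate `α̇ / (1 - α)` on the time interval `[0, 1)`. -/
def noiseRate (t : ℝ) : ℝ :=
  (Ico (0 : ℝ) 1).indicator (fun u => derivWithin M.α (Ico 0 1) u / (1 - M.α u)) t

/-- The product of noise removal rate, planner and denoiser. -/
def jumpRate (t : ℝ) (x : Fin D → Fin S) (d : Fin D) (j : Fin S) : ℝ :=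
  M.noiseRate t * M.planner t x d * M.denoiser t x d j

lemma noiseRate_nonneg (t : ℝ) : 0 ≤ M.noiseRate t := by
  refine indicator_nonneg (fun u hu => ?_) t
  exact div_nonneg M.monotoneOn_α.derivWithin_nonneg (sub_nonneg.2 (M.α_lt_one u hu).le)

lemma jumpRate_nonneg (t : ℝ) (x : Fin D → Fin S) (d : Fin D) (j : Fin S) :
    0 ≤ M.jumpRate t x d j :=
  mul_nonneg (mul_nonneg (M.noiseRate_nonneg t) (M.planner_mem t x d).1)
    (M.denoiser_nonneg t x d j)

lemma measurable_noiseRate : Measurable M.noiseRate := by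
  classical
  have hα : Measurable ((Ico (0 : ℝ) 1).indicator M.α) := by
    have := ContinuousOn.measurable_piecewise (s := Ico (0 : ℝ) 1) (f := M.α) (g := fun _ => 0)
      M.differentiableOn_α.continuousOn continuousOn_const measurableSet_Ico
    exact (Set.piecewise_eq_indicator (s := Ico (0 : ℝ) 1) (f := M.α)) ▸ this
  have h : M.noiseRate = fun t =>
      (if t = 0 then derivWithin M.α (Ico 0 1) 0 else
        (Ioo (0 : ℝ) 1).indicator (deriv M.α) t) / (1 - (Ico (0 : ℝ) 1).indicator M.α t) := by
    funext t
    unfold noiseRate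
    by_cases h0 : t = 0
    · subst h0; simp
    · by_cases ht : t ∈ Ioo (0 : ℝ) 1
      · have ht' : t ∈ Ico (0 : ℝ) 1 := Ioo_subset_Ico_self ht
        simp [h0, ht, ht', derivWithin_of_mem_nhds (Ico_mem_nhds ht.1 ht.2)]
      · have ht' : t ∉ Ico (0 : ℝ) 1 := fun h =>
          ht ⟨lt_of_le_of_ne h.1 (Ne.symm h0), h.2⟩
        simp [h0, ht, ht']
  rw [h]
  refine Measurable.div ?_ (measurable_const.sub hα)
  exact Measurable.ite (MeasurableSet.singleton 0) measurable_const
    ((measurable_deriv _).indicator measurableSet_Ioo)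

lemma measurable_jumpRate (x : Fin D → Fin S) (d : Fin D) (j : Fin S) :
    Measurable fun t => M.jumpRate t x d j :=
  (M.measurable_noiseRate.mul (M.measurable_planner x d)).mul (M.measurable_denoiser x d j)

/-- For `y ≠ x`, the rate of jumping from `x` to `y`: dimension `d` of `x` changes to a value
`j ≠ x d` with rate `jumpRate t x d j`, and all other dimensions keep their values. -/
def offDiagRate (t : ℝ) (x y : Fin D → Fin S) : ℝ :=
  ∑ d, ∑ j, if j ≠ x d ∧ Function.update x d j = y then M.jumpRate t x d j else 0

/-- The rate matrix of the original process: off-diagonal entries as given by the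
planner and the denoiser, and diagonal entries such that each row sums to zero. -/
def rateMatrix (t : ℝ) : Matrix (Fin D → Fin S) (Fin D → Fin S) ℝ := fun x y =>
  if y = x then - ∑ y' ∈ Finset.univ.erase x, M.offDiagRate t x y' else M.offDiagRate t x y

lemma measurable_offDiagRate (x y : Fin D → Fin S) :
    Measurable fun t => M.offDiagRate t x y := by
  unfold offDiagRate
  refine Finset.measurable_sum _ fun d _ => Finset.measurable_sum _ fun j _ => ?_
  split_ifs
  · exact M.measurable_jumpRate x d j
  · exact measurable_const

lemma measurable_rateMatrix (x y : Fin D → Fin S) :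
    Measurable fun t => M.rateMatrix t x y := by
  unfold rateMatrix
  split_ifs
  · exact (Finset.measurable_sum _ fun y' _ => M.measurable_offDiagRate x y').neg
  · exact M.measurable_offDiagRate x y

/-- The original continuous-time Markov chain, without self-loops. -/
def ctmc : JumpMechanism (Fin D → Fin S) (Fin D → Fin S) :=
  ctmcMechanism M.rateMatrix M.measurable_rateMatrix

/-- The self-loop process: in state `x`, every pair `(d, j)` of a dimension and a value fires with
rate `jumpRate t x d j`, including `j = x d`, and sets dimension `d` of the state to `j`. -/
def selfLoop : JumpMechanism (Fin D → Fin S) (Fin D × Fin S) where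
  rate t x e := (M.jumpRate t x e.1 e.2).toNNReal
  measurable_rate x e := (M.measurable_jumpRate x e.1 e.2).real_toNNReal
  act x e := Function.update x e.1 e.2

end PlannerDenoiser

end

noncomputable section

set_option linter.unusedSectionVars false

/-- The survival probability `exp (-a)` of a standard exponential variable, as an extended
nonnegative real, for an extended nonnegative threshold `a`. It is used for finite `a` only. -/
def expNeg (a : ℝ≥0∞) : ℝ≥0∞ := ENNReal.ofReal (Real.exp (-a.toReal))

@[simp] lemma expNeg_zero : expNeg 0 = 1 := by simp [expNeg]

lemma expNeg_add {a b : ℝ≥0∞} (ha : a ≠ ∞) (hb : b ≠ ∞) :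
    expNeg (a + b) = expNeg a * expNeg b := by
  rw [expNeg, expNeg, expNeg, ENNReal.toReal_add ha hb, neg_add, Real.exp_add,
    ENNReal.ofReal_mul (Real.exp_nonneg _)]

lemma expNeg_ne_top (a : ℝ≥0∞) : expNeg a ≠ ∞ := ENNReal.ofReal_ne_top

lemma measurable_expNeg : Measurable expNeg := by
  unfold expNeg
  fun_prop

lemma AbsolutelyContinuousOnInterval.exp_neg {f : ℝ → ℝ} {a b : ℝ}
    (hf : AbsolutelyContinuousOnInterval f a b) (h0 : ∀ x ∈ uIcc a b, 0 ≤ f x) :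
    AbsolutelyContinuousOnInterval (fun x => Real.exp (-f x)) a b := by
  rw [absolutelyContinuousOnInterval_iff] at hf ⊢
  intro ε hε
  obtain ⟨δ, hδ, h⟩ := hf ε hε
  refine ⟨δ, hδ, fun E hE hE' => (Finset.sum_le_sum fun i hi => ?_).trans_lt (h E hE hE')⟩
  have key : ∀ u v : ℝ, 0 ≤ u → u ≤ v → |Real.exp (-u) - Real.exp (-v)| ≤ |u - v| := by
    intro u v hu huv
    have h1 : Real.exp (-v) ≤ Real.exp (-u) := Real.exp_le_exp.2 (by linarith)
    have h2 : Real.exp (-u) ≤ 1 := Real.exp_le_one_iff.2 (by linarith)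
    have h3 : 1 - (v - u) ≤ Real.exp (-(v - u)) := Real.one_sub_le_exp_neg _
    have h4 : Real.exp (-v) = Real.exp (-u) * Real.exp (-(v - u)) := by
      rw [← Real.exp_add]; congr 1; ring
    rw [abs_of_nonneg (by linarith), abs_of_nonpos (by linarith), h4]
    nlinarith [Real.exp_nonneg (-u)]
  have hm := hE.1 i hi
  have h1 := h0 _ hm.1
  have h2 := h0 _ hm.2
  rw [Real.dist_eq, Real.dist_eq]
  rcases le_total (f (E.2 i).1) (f (E.2 i).2) with hle | hle
  · exact key _ _ h1 hle
  · rw [abs_sub_comm, abs_sub_comm (f _)]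
    exact key _ _ h2 hle

lemma setLIntegral_mul_expNeg_add {f : ℝ → ℝ≥0} (hf : Measurable f) {s t : ℝ} (hst : s ≤ t)
    (hfin : ∫⁻ u in Ioo s t, f u ≠ ∞) :
    (∫⁻ u in Ioo s t, f u * expNeg (∫⁻ v in Ioo s u, f v)) + expNeg (∫⁻ u in Ioo s t, f u)
      = 1 := by
  have hint : IntervalIntegrable (fun u => (f u : ℝ)) volume s t := by
    rw [intervalIntegrable_iff_integrableOn_Ioo_of_le hst]
    refine ⟨hf.coe_nnreal_real.aestronglyMeasurable, ?_⟩
    rw [hasFiniteIntegral_iff_enorm]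
    simpa [lt_top_iff_ne_top] using hfin
  have hA : ∀ u, s ≤ u → (∫⁻ v in Ioo s u, (f v : ℝ≥0∞)).toReal = ∫ v in s..u, (f v : ℝ) := by
    intro u hu
    rw [intervalIntegral.integral_of_le hu, integral_Ioc_eq_integral_Ioo,
      ← integral_toReal hf.coe_nnreal_ennreal.aemeasurable (by simp)]
    simp
  set A : ℝ → ℝ := fun u => ∫ v in s..u, (f v : ℝ) with hAdef
  have hA0 : ∀ u ∈ uIcc s t, 0 ≤ A u := by
    intro u hu
    rw [uIcc_of_le hst] at hu
    exact intervalIntegral.integral_nonneg hu.1 fun _ _ => NNReal.coe_nonneg _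
  have hac : AbsolutelyContinuousOnInterval (fun u => Real.exp (-A u)) s t :=
    (hint.absolutelyContinuousOnInterval_intervalIntegral left_mem_uIcc).exp_neg hA0
  have hderiv : ∀ᵐ u, u ∈ uIcc s t →
      deriv (fun u => Real.exp (-A u)) u = -(f u * Real.exp (-A u)) := by
    filter_upwards [hint.ae_hasDerivAt_integral] with u hu hus
    have hd : HasDerivAt (fun u => Real.exp (-A u)) (Real.exp (-A u) * -f u) u :=
      (hu hus s left_mem_uIcc).neg.exp
    rw [hd.deriv]; ring
  have hFTC := hac.integral_deriv_eq_sub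
  have hI : ∫ u in s..t, deriv (fun u => Real.exp (-A u)) u
      = - ∫ u in s..t, f u * Real.exp (-A u) := by
    rw [← intervalIntegral.integral_neg]
    refine intervalIntegral.integral_congr_ae ?_
    filter_upwards [hderiv] with u hu hus
    exact hu (uIoc_subset_uIcc hus)
  have hAs : A s = 0 := by simp [hAdef]
  rw [hI, hAs] at hFTC
  have hint2 : IntegrableOn (fun u => f u * Real.exp (-A u)) (Ioo s t) := by
    rw [← intervalIntegrable_iff_integrableOn_Ioo_of_le hst]
    refine hint.mul_continuousOn hac.continuousOn
  have hL : ∫⁻ u in Ioo s t, f u * expNeg (∫⁻ v in Ioo s u, f v)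
      = ENNReal.ofReal (∫ u in s..t, f u * Real.exp (-A u)) := by
    rw [intervalIntegral.integral_of_le hst, integral_Ioc_eq_integral_Ioo,
      ofReal_integral_eq_lintegral_ofReal hint2
        (Filter.Eventually.of_forall fun u => by positivity)]
    refine setLIntegral_congr_fun measurableSet_Ioo fun u hu => ?_
    simp only [expNeg]
    rw [hA u hu.1.le, ENNReal.ofReal_mul (by positivity), ENNReal.ofReal_coe_nnreal]
  have hnn : 0 ≤ ∫ u in s..t, f u * Real.exp (-A u) :=
    intervalIntegral.integral_nonneg hst fun _ _ => by positivity
  rw [hL, expNeg, hA t hst, ← ENNReal.ofReal_add hnn (Real.exp_nonneg _)]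
  simp only [neg_zero, Real.exp_zero] at hFTC
  rw [show (∫ u in s..t, f u * Real.exp (-A u)) + Real.exp (-A t) = 1 by linarith]
  simp

lemma expMeasure_Iic (x : ℝ) (hx : 0 ≤ x) :
    expMeasure 1 (Iic x) = 1 - ENNReal.ofReal (Real.exp (-x)) := by
  have h := cdf_expMeasure_eq one_pos x
  rw [cdf_eq_real, if_pos hx, one_mul] at h
  rw [← ENNReal.ofReal_one, ← ENNReal.ofReal_sub _ (Real.exp_nonneg _), ← h, measureReal_def,
    ENNReal.ofReal_toReal (measure_ne_top _ _)]

lemma expMeasure_ae_pos : ∀ᵐ ξ ∂expMeasure 1, 0 < ξ := by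
  have h := expMeasure_Iic 0 le_rfl
  simp only [neg_zero, Real.exp_zero, ENNReal.ofReal_one, tsub_self] at h
  rw [ae_iff]
  convert h using 2
  ext; simp

lemma lintegral_exp_neg_expMeasure :
    ∫⁻ ξ, ENNReal.ofReal (Real.exp (-ξ)) ∂expMeasure 1 = 2⁻¹ := by
  have h : ∀ ξ, exponentialPDF 1 ξ * ENNReal.ofReal (Real.exp (-ξ))
      = 2⁻¹ * exponentialPDF 2 ξ := by
    intro ξ
    rcases lt_or_ge ξ 0 with hξ | hξ
    · simp [exponentialPDF_of_neg hξ]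
    · rw [exponentialPDF_of_nonneg hξ, exponentialPDF_of_nonneg hξ,
        ← ENNReal.ofReal_mul (by positivity),
        show (2⁻¹ : ℝ≥0∞) = ENNReal.ofReal 2⁻¹ by
          rw [ENNReal.ofReal_inv_of_pos two_pos]; simp,
        ← ENNReal.ofReal_mul (by positivity)]
      congr 1
      rw [one_mul, ← Real.exp_add, ← mul_assoc, inv_mul_cancel₀ two_ne_zero, one_mul]
      ring_nf
  have hm : Measurable (exponentialPDF 1) :=
    (measurable_exponentialPDFReal 1).ennreal_ofReal
  change ∫⁻ ξ, _ ∂(volume.withDensity (exponentialPDF 1)) = _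
  rw [lintegral_withDensity_eq_lintegral_mul _ hm (by fun_prop)]
  simp only [Pi.mul_apply, h]
  rw [lintegral_const_mul _ (show Measurable (exponentialPDF 2) from
      (measurable_exponentialPDFReal 2).ennreal_ofReal),
    lintegral_exponentialPDF_eq_one two_pos, mul_one]

namespace JumpMechanism

section Basic

variable {X E : Type*} [Fintype E] (J : JumpMechanism X E)

lemma cumRate_add (x : X) {s t u : ℝ} (hst : s ≤ t) (htu : t ≤ u) :
    J.cumRate x s u = J.cumRate x s t + J.cumRate x t u := by
  have h : ∀ a b : ℝ, J.cumRate x a b = ∫⁻ u in Ioc a b, (J.total u x : ℝ≥0∞) := fun a b =>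
    setLIntegral_congr Ioo_ae_eq_Ioc
  rw [h, h, h, ← lintegral_union measurableSet_Ioc (Ioc_disjoint_Ioc_of_le le_rfl),
    Ioc_union_Ioc_eq_Ioc hst htu]

lemma cumRate_eq_zero (x : X) {s t : ℝ} (h : t ≤ s) : J.cumRate x s t = 0 := by
  simp [cumRate, Ioo_eq_empty (not_lt.2 h)]

/-- The integrated rates are right-continuous. -/
lemma le_cumRate_of_forall_gt (x : X) {s t b : ℝ} {a : ℝ≥0∞} (htb : t < b)
    (hb : J.cumRate x s b ≠ ∞) (h : ∀ u ∈ Ioo t b, a ≤ J.cumRate x s u) :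
    a ≤ J.cumRate x s t := by
  have hI : ∀ u, J.cumRate x s u = ∫⁻ v in Ioc s u, (J.total v x : ℝ≥0∞) := fun u =>
    setLIntegral_congr Ioo_ae_eq_Ioc
  obtain ⟨q, hq, hqm, hqt⟩ := exists_seq_strictAnti_tendsto' htb
  let μ := volume.withDensity fun v => (J.total v x : ℝ≥0∞)
  have hμ : ∀ u, J.cumRate x s u = μ (Ioc s u) := fun u => by
    rw [hI, withDensity_apply _ measurableSet_Ioc]
  have hlim := tendsto_measure_iInter_atTop (μ := μ) (s := fun n => Ioc s (q n))
    (fun n => measurableSet_Ioc.nullMeasurableSet)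
    (fun m n hmn => Ioc_subset_Ioc_right (hq.antitone hmn))
    ⟨0, by
      rw [← hμ]
      exact ((J.cumRate_mono x s (hqm 0).2.le).trans_lt hb.lt_top).ne⟩
  have hinter : ⋂ n, Ioc s (q n) = Ioc s t := by
    ext v
    simp only [mem_iInter, mem_Ioc]
    refine ⟨fun hv => ⟨(hv 0).1, ge_of_tendsto' hqt fun n => (hv n).2⟩,
      fun hv n => ⟨hv.1, hv.2.trans (hqm n).1.le⟩⟩
  rw [hinter] at hlim
  rw [hμ]
  refine ge_of_tendsto' hlim fun n => ?_
  change a ≤ μ (Ioc s (q n))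
  rw [← hμ]
  exact h _ (hqm n)

variable {J} in
lemma le_nextTime {p : ℝ × X} (hp : p.1 ≤ 1) (ξ : ℝ) : p.1 ≤ J.nextTime p ξ := by
  refine le_csInf ⟨1, Or.inr rfl⟩ ?_
  rintro t (ht | rfl)
  · exact ht.1.1.le
  · exact hp

lemma bddBelow_nextTime_set (p : ℝ × X) (ξ : ℝ) :
    BddBelow ({t | t ∈ Ioo p.1 1 ∧ ENNReal.ofReal ξ ≤ J.cumRate p.2 p.1 t} ∪ {1}) := by
  refine ⟨min p.1 1, ?_⟩
  rintro t (ht | rfl)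
  · exact (min_le_left _ _).trans ht.1.1.le
  · exact min_le_right _ _

lemma nextTime_le_one (p : ℝ × X) (ξ : ℝ) : J.nextTime p ξ ≤ 1 :=
  csInf_le (J.bddBelow_nextTime_set p ξ) (Or.inr rfl)

lemma nextTime_of_one_le {p : ℝ × X} (hp : 1 ≤ p.1) (ξ : ℝ) : J.nextTime p ξ = 1 := by
  simp [nextTime, Ioo_eq_empty (not_lt.2 hp)]

/-- The rates are integrable over intervals that are bounded away from time `1`. -/
def LocallyFinite : Prop := ∀ x s t, t < 1 → J.cumRate x s t ≠ ∞

variable {J}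

lemma LocallyFinite.le_cumRate_nextTime (hJ : J.LocallyFinite) {p : ℝ × X} {ξ : ℝ}
    (h : J.nextTime p ξ < 1) :
    ENNReal.ofReal ξ ≤ J.cumRate p.2 p.1 (J.nextTime p ξ) := by
  obtain ⟨b, hb, hb1⟩ := exists_between h
  refine J.le_cumRate_of_forall_gt p.2 hb (hJ _ _ _ hb1) fun u hu => ?_
  rcases (J.nextTime_lt_iff p ξ u).1 hu.1 with h1 | ⟨q, hq, -, hq2⟩
  · linarith [hu.2]
  · exact hq2.trans (J.cumRate_mono _ _ hq.le)

lemma LocallyFinite.nextTime_le_iff (hJ : J.LocallyFinite) {p : ℝ × X} {ξ t : ℝ}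
    (hpt : p.1 < t) (ht : t < 1) :
    J.nextTime p ξ ≤ t ↔ ENNReal.ofReal ξ ≤ J.cumRate p.2 p.1 t := by
  constructor
  · intro h
    exact (hJ.le_cumRate_nextTime (h.trans_lt ht)).trans (J.cumRate_mono _ _ h)
  · intro h
    exact csInf_le (J.bddBelow_nextTime_set p ξ) (Or.inl ⟨⟨hpt, ht⟩, h⟩)

end Basic

end JumpMechanism

namespace JumpMechanism

variable {X E : Type*} [Fintype X] [MeasurableSpace X] [DiscreteMeasurableSpace X]
  [Fintype E] {J : JumpMechanism X E}

variable (J) in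
lemma timeKernel_apply (p : ℝ × X) : J.timeKernel p = (expMeasure 1).map (J.nextTime p) := by
  rw [timeKernel, Kernel.map_apply _ J.measurable_nextTime, Kernel.prod_apply, Kernel.id_apply,
    Kernel.const_apply, Measure.dirac_prod, Measure.map_map J.measurable_nextTime (by fun_prop)]
  rfl

variable (J) in
lemma measurable_nextTime_right (p : ℝ × X) : Measurable (J.nextTime p) := by
  have h : Measurable ((fun a : (ℝ × X) × ℝ => J.nextTime a.1 a.2) ∘ Prod.mk p) :=
    J.measurable_nextTime.comp measurable_prodMk_left
  exact h

variable (J) in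
lemma lintegral_step (p : ℝ × X) {f : ℝ × X → ℝ≥0∞} (hf : Measurable f) :
    ∫⁻ q, f q ∂J.step p = ∫⁻ u, ∫⁻ y, f (u, y) ∂J.nextLaw u p.2 ∂J.timeKernel p := by
  rw [step, Kernel.lintegral_compProd _ _ _ hf]
  rfl

variable (J) in
lemma map_fst_step (p : ℝ × X) :
    (J.step p).map Prod.fst = (expMeasure 1).map (J.nextTime p) := by
  rw [← timeKernel_apply, ← Kernel.fst_apply, step, Kernel.fst_compProd]

variable (J) in
lemma ae_step_time_mem (p : ℝ × X) : ∀ᵐ q ∂J.step p, min p.1 1 ≤ q.1 ∧ q.1 ≤ 1 := by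
  have h : ∀ᵐ u ∂(J.step p).map Prod.fst, min p.1 1 ≤ u ∧ u ≤ 1 := by
    rw [map_fst_step]
    refine (ae_map_iff (J.measurable_nextTime_right p).aemeasurable
      (measurableSet_Icc (a := min p.1 1) (b := 1))).2 (Filter.Eventually.of_forall fun ξ => ?_)
    refine ⟨?_, J.nextTime_le_one p ξ⟩
    rcases le_total p.1 1 with hp | hp
    · exact (min_le_left _ _).trans (le_nextTime hp ξ)
    · rw [J.nextTime_of_one_le hp]; exact min_le_right _ _
  exact ae_of_ae_map measurable_fst.aemeasurable h

/-- The waiting time for the next jump is exponential with time-dependent rate `total`. -/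
lemma LocallyFinite.timeKernel_Iic (hJ : J.LocallyFinite) (p : ℝ × X) {t : ℝ} (ht : t < 1) :
    J.timeKernel p (Iic t) = 1 - expNeg (J.cumRate p.2 p.1 t) := by
  have hfin := hJ p.2 p.1 t ht
  rw [timeKernel_apply, Measure.map_apply (J.measurable_nextTime_right p) measurableSet_Iic]
  have hcongr : J.nextTime p ⁻¹' Iic t =ᵐ[expMeasure 1] Iic (J.cumRate p.2 p.1 t).toReal := by
    filter_upwards [expMeasure_ae_pos] with ξ hξ
    refine propext ?_
    change J.nextTime p ξ ≤ t ↔ ξ ≤ _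
    rw [← ENNReal.ofReal_le_iff_le_toReal hfin]
    rcases lt_or_ge p.1 t with hpt | hpt
    · exact hJ.nextTime_le_iff hpt ht
    · have hz := J.cumRate_eq_zero p.2 hpt
      constructor
      · intro h
        exact (hJ.le_cumRate_nextTime (h.trans_lt ht)).trans (J.cumRate_mono _ _ h)
      · intro h
        rw [hz, nonpos_iff_eq_zero, ENNReal.ofReal_eq_zero] at h
        exact absurd h (not_le.2 hξ)
  rw [measure_congr hcongr, expMeasure_Iic _ ENNReal.toReal_nonneg, expNeg]

lemma expNeg_le_one (a : ℝ≥0∞) : expNeg a ≤ 1 := by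
  rw [expNeg, ENNReal.ofReal_le_one, Real.exp_le_one_iff, neg_nonpos]
  exact ENNReal.toReal_nonneg

lemma LocallyFinite.timeKernel_Ioi (hJ : J.LocallyFinite) (p : ℝ × X) {t : ℝ} (ht : t < 1) :
    J.timeKernel p (Ioi t) = expNeg (J.cumRate p.2 p.1 t) := by
  rw [← compl_Iic, prob_compl_eq_one_sub measurableSet_Iic, hJ.timeKernel_Iic p ht,
    ENNReal.sub_sub_cancel ENNReal.one_ne_top (expNeg_le_one _)]

lemma LocallyFinite.restrict_timeKernel (hJ : J.LocallyFinite) (s : ℝ) (x : X) {T : ℝ}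
    (hT : T < 1) :
    (J.timeKernel (s, x)).restrict (Iic T) = (volume.restrict (Ioo s T)).withDensity
      fun u => J.total u x * expNeg (J.cumRate x s u) := by
  have h : ∀ a, (J.timeKernel (s, x)).restrict (Iic T) (Iic a)
      = (volume.restrict (Ioo s T)).withDensity
          (fun u => J.total u x * expNeg (J.cumRate x s u)) (Iic a) := by
    intro a
    have hb : min a T < 1 := (min_le_right _ _).trans_lt hT
    rw [Measure.restrict_apply measurableSet_Iic, Iic_inter_Iic, hJ.timeKernel_Iic _ hb,
      withDensity_apply _ measurableSet_Iic, Measure.restrict_restrict measurableSet_Iic]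
    have hae : (Iic a ∩ Ioo s T : Set ℝ) =ᵐ[volume] Ioo s (min a T) := by
      have : (Iic a ∩ Ioo s T : Set ℝ) =ᵐ[volume] (Iio a ∩ Ioo s T : Set ℝ) :=
        Iio_ae_eq_Iic.symm.inter (ae_eq_refl _)
      refine this.trans (Filter.Eventually.of_forall fun u => propext ?_)
      change (u < a ∧ s < u ∧ u < T) ↔ (s < u ∧ u < min a T)
      rw [lt_min_iff]; tauto
    rw [setLIntegral_congr hae]
    rcases le_total s (min a T) with hs | hs
    · have := setLIntegral_mul_expNeg_add (J.measurable_total x) hs (hJ x s _ hb)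
      rw [← this]
      exact ENNReal.add_sub_cancel_right (expNeg_ne_top _)
    · simp [Ioo_eq_empty (not_lt.2 hs), J.cumRate_eq_zero x hs]
  have : IsFiniteMeasure ((volume.restrict (Ioo s T)).withDensity
      fun u => J.total u x * expNeg (J.cumRate x s u)) := by
    refine ⟨?_⟩
    have hle : ∀ n : ℕ, (volume.restrict (Ioo s T)).withDensity
        (fun u => J.total u x * expNeg (J.cumRate x s u)) (Iic (n : ℝ)) ≤ 1 := fun n => by
      rw [← h]; exact prob_le_one.trans' (Measure.restrict_apply_le _ _)
    have := tendsto_measure_iUnion_atTop (μ := (volume.restrict (Ioo s T)).withDensity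
        (fun u => J.total u x * expNeg (J.cumRate x s u))) (s := fun n : ℕ => Iic (n : ℝ))
        (fun m n hmn => Iic_subset_Iic.2 (Nat.cast_le.2 hmn))
    have hU : ⋃ n : ℕ, Iic (n : ℝ) = univ := iUnion_eq_univ_iff.2 fun r => exists_nat_ge r
    rw [hU] at this
    exact (le_of_tendsto' this hle).trans_lt ENNReal.one_lt_top
  exact Measure.ext_of_Iic _ _ h

variable (J) in
lemma total_mul_lintegral_nextLaw {u : ℝ} (hu : u < 1) (x : X) (f : X → ℝ≥0∞) :
    J.total u x * ∫⁻ y, f y ∂J.nextLaw u x = ∑ e, J.rate u x e * f (J.act x e) := by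
  have hf : Measurable f := Measurable.of_discrete
  by_cases h : J.total u x = 0
  · have hz : ∀ e, J.rate u x e = 0 := fun e =>
      (Finset.sum_eq_zero_iff.1 h) e (Finset.mem_univ e)
    simp [h, hz]
  · rw [nextLaw, if_pos ⟨hu, h⟩, lintegral_finsetSum_measure, Finset.mul_sum]
    refine Finset.sum_congr rfl fun e _ => ?_
    rw [lintegral_smul_measure, lintegral_dirac' _ hf, smul_eq_mul, ← mul_assoc, eventProb,
      ← ENNReal.coe_mul, mul_div_cancel₀ _ h]

variable (J) in
lemma measurable_expNeg_cumRate (x : X) (s : ℝ) :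
    Measurable fun u => expNeg (J.cumRate x s u) :=
  measurable_expNeg.comp (J.cumRate_mono x s).measurable

/-- The first jump before time `T`, if any, has the rates as a density. -/
lemma LocallyFinite.setLIntegral_step (hJ : J.LocallyFinite) (s : ℝ) (x : X) {T : ℝ}
    (hT : T < 1) {f : ℝ × X → ℝ≥0∞} (hf : Measurable f) :
    ∫⁻ q in {q | q.1 ≤ T}, f q ∂J.step (s, x)
      = ∫⁻ u in Ioo s T, expNeg (J.cumRate x s u) * ∑ e, J.rate u x e * f (u, J.act x e) := by
  have hS : MeasurableSet {q : ℝ × X | q.1 ≤ T} := measurableSet_le measurable_fst measurable_const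
  have hm : Measurable fun u => ∫⁻ y, f (u, y) ∂J.nextLaw u x := by
    have h1 : Measurable (Function.uncurry fun (u : ℝ) (y : X) => f (u, y)) := hf
    have h2 := Measurable.lintegral_kernel_prod_right
      (κ := J.stateKernel.comap (fun u : ℝ => (((0 : ℝ), x), u)) (by fun_prop)) h1
    exact h2
  rw [← lintegral_indicator hS, lintegral_step _ _ (hf.indicator hS)]
  have : ∀ u, ∫⁻ y, {q : ℝ × X | q.1 ≤ T}.indicator f (u, y) ∂J.nextLaw u x
      = (Iic T).indicator (fun u => ∫⁻ y, f (u, y) ∂J.nextLaw u x) u := by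
    intro u
    by_cases hu : u ≤ T
    · rw [indicator_of_mem (mem_Iic.2 hu)]
      refine lintegral_congr fun y => ?_
      rw [indicator_of_mem]; exact hu
    · rw [indicator_of_notMem (by simpa using hu)]
      have : ∀ y, {q : ℝ × X | q.1 ≤ T}.indicator f (u, y) = 0 := fun y =>
        indicator_of_notMem (by simpa using hu) _
      simp [this]
  simp_rw [this]
  rw [lintegral_indicator measurableSet_Iic, hJ.restrict_timeKernel s x hT,
    lintegral_withDensity_eq_lintegral_mul _ (show Measurable
        fun u => (J.total u x : ℝ≥0∞) * expNeg (J.cumRate x s u) from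
      (J.measurable_total x).coe_nnreal_ennreal.mul (J.measurable_expNeg_cumRate x s)) hm]
  refine setLIntegral_congr_fun measurableSet_Ioo fun u hu => ?_
  simp only [Pi.mul_apply]
  rw [← J.total_mul_lintegral_nextLaw (hu.2.trans hT) x fun y => f (u, y)]
  ring

lemma LocallyFinite.step_Ioi (hJ : J.LocallyFinite) (s : ℝ) (x : X) {T : ℝ} (hT : T < 1) :
    J.step (s, x) {q | T < q.1} = expNeg (J.cumRate x s T) := by
  rw [← hJ.timeKernel_Ioi (s, x) hT, timeKernel_apply, ← map_fst_step,
    Measure.map_apply measurable_fst measurableSet_Ioi]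
  rfl

/-- A function that the simulation decreases by a factor of two per round, in expectation. -/
def lyapunov (J : JumpMechanism X E) (T : ℝ) (q : ℝ × X) : ℝ≥0∞ :=
  {q : ℝ × X | q.1 ≤ T}.indicator
    (fun q => ENNReal.ofReal (Real.exp (∑ x, (J.cumRate x q.1 T).toReal))) q

variable (J) in
lemma measurable_lyapunov (T : ℝ) : Measurable (J.lyapunov T) := by
  refine Measurable.indicator ?_ (measurableSet_le measurable_fst measurable_const)
  refine (Real.measurable_exp.comp ?_).ennreal_ofReal
  exact Finset.measurable_sum _ fun x _ =>
    ((J.measurable_cumRate x T).comp measurable_fst).ennreal_toReal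

lemma LocallyFinite.lintegral_lyapunov_le (hJ : J.LocallyFinite) {T : ℝ} (hT : T < 1)
    (p : ℝ × X) : ∫⁻ q, J.lyapunov T q ∂J.step p ≤ 2⁻¹ * J.lyapunov T p := by
  let V : ℝ → ℝ≥0∞ := fun t => J.lyapunov T (t, p.2)
  have hV : ∀ q : ℝ × X, J.lyapunov T q = V q.1 := fun q => rfl
  have hVm : Measurable V := (J.measurable_lyapunov T).comp (by fun_prop)
  simp_rw [hV]
  rw [← lintegral_map hVm measurable_fst, map_fst_step,
    lintegral_map hVm (J.measurable_nextTime_right p), mul_comm, ← lintegral_exp_neg_expMeasure,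
    ← lintegral_const_mul _ (by fun_prop)]
  refine lintegral_mono_ae ?_
  filter_upwards [expMeasure_ae_pos] with ξ hξ
  by_cases h : J.nextTime p ξ ≤ T
  · have h1 : J.nextTime p ξ < 1 := h.trans_lt hT
    have hp1 : p.1 < 1 := by
      by_contra! hp
      rw [J.nextTime_of_one_le hp] at h1
      exact lt_irrefl _ h1
    have hp := le_nextTime hp1.le ξ (J := J)
    have hle := hJ.le_cumRate_nextTime h1
    set τ := J.nextTime p ξ
    have hVτ : V τ = ENNReal.ofReal (Real.exp (∑ x, (J.cumRate x τ T).toReal)) :=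
      indicator_of_mem (s := {q : ℝ × X | q.1 ≤ T}) (a := (τ, p.2)) h _
    have hVp : V p.1 = ENNReal.ofReal (Real.exp (∑ x, (J.cumRate x p.1 T).toReal)) :=
      indicator_of_mem (s := {q : ℝ × X | q.1 ≤ T}) (a := (p.1, p.2)) (hp.trans h) _
    rw [hVτ, hVp, ← ENNReal.ofReal_mul (Real.exp_nonneg _), ← Real.exp_add]
    refine ENNReal.ofReal_le_ofReal (Real.exp_le_exp.2 ?_)
    have hadd : ∀ x, (J.cumRate x p.1 T).toReal
        = (J.cumRate x p.1 τ).toReal + (J.cumRate x τ T).toReal := fun x => by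
      rw [J.cumRate_add x hp h, ENNReal.toReal_add (hJ _ _ _ h1) (hJ _ _ _ hT)]
    simp_rw [hadd, Finset.sum_add_distrib]
    have h2 : ξ ≤ (J.cumRate p.2 p.1 τ).toReal :=
      (ENNReal.ofReal_le_iff_le_toReal (hJ _ _ _ h1)).1 hle
    have h3 : (J.cumRate p.2 p.1 τ).toReal ≤ ∑ x, (J.cumRate x p.1 τ).toReal :=
      Finset.single_le_sum (f := fun x => (J.cumRate x p.1 τ).toReal)
        (fun _ _ => ENNReal.toReal_nonneg) (Finset.mem_univ p.2)
    linarith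
  · have : V (J.nextTime p ξ) = 0 :=
      indicator_of_notMem (s := {q : ℝ × X | q.1 ≤ T}) (a := (J.nextTime p ξ, p.2)) h _
    simp [this]

lemma one_le_lyapunov {T : ℝ} {q : ℝ × X} (h : q.1 ≤ T) : 1 ≤ J.lyapunov T q := by
  rw [lyapunov, indicator_of_mem (s := {q : ℝ × X | q.1 ≤ T}) h, ENNReal.one_le_ofReal]
  exact Real.one_le_exp (Finset.sum_nonneg fun _ _ => ENNReal.toReal_nonneg)

end JumpMechanism

lemma setLIntegral_mul_setLIntegral_swap {a H : ℝ → ℝ≥0∞} (ha : Measurable a) (hH : Measurable H)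
    (s T : ℝ) :
    ∫⁻ u in Ioo s T, a u * ∫⁻ v in Ioo u T, H v
      = ∫⁻ v in Ioo s T, H v * ∫⁻ u in Ioo s v, a u := by
  let S : Set (ℝ × ℝ) := {q | s < q.1 ∧ q.1 < q.2 ∧ q.2 < T}
  have hS : MeasurableSet S := (measurableSet_lt measurable_const measurable_fst).inter
    ((measurableSet_lt measurable_fst measurable_snd).inter
      (measurableSet_lt measurable_snd measurable_const))
  let k : ℝ → ℝ → ℝ≥0∞ := fun u v => S.indicator (fun q => a q.1 * H q.2) (u, v)
  have hk : Measurable (Function.uncurry k) :=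
    ((ha.comp measurable_fst).mul (hH.comp measurable_snd)).indicator hS
  have hl : ∀ u, (Ioo s T).indicator (fun u => a u * ∫⁻ v in Ioo u T, H v) u = ∫⁻ v, k u v := by
    intro u
    by_cases hu : u ∈ Ioo s T
    · rw [indicator_of_mem hu, ← lintegral_const_mul _ hH, ← lintegral_indicator measurableSet_Ioo]
      refine lintegral_congr fun v => ?_
      by_cases hv : v ∈ Ioo u T
      · rw [indicator_of_mem hv]
        exact (indicator_of_mem (s := S) (a := (u, v)) ⟨hu.1, hv.1, hv.2⟩
          (fun q => a q.1 * H q.2)).symm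
      · rw [indicator_of_notMem hv]
        exact (indicator_of_notMem (s := S) (fun h => hv ⟨h.2.1, h.2.2⟩) _).symm
    · rw [indicator_of_notMem hu, ← lintegral_zero (μ := (volume : Measure ℝ))]
      refine lintegral_congr fun v => ?_
      exact (indicator_of_notMem (s := S) (fun h => hu ⟨h.1, h.2.1.trans h.2.2⟩) _).symm
  have hr : ∀ v, (Ioo s T).indicator (fun v => H v * ∫⁻ u in Ioo s v, a u) v = ∫⁻ u, k u v := by
    intro v
    by_cases hv : v ∈ Ioo s T
    · rw [indicator_of_mem hv, ← lintegral_const_mul _ ha, ← lintegral_indicator measurableSet_Ioo]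
      refine lintegral_congr fun u => ?_
      by_cases hu : u ∈ Ioo s v
      · rw [indicator_of_mem hu, mul_comm]
        exact (indicator_of_mem (s := S) (a := (u, v)) ⟨hu.1, hu.2, hv.2⟩
          (fun q => a q.1 * H q.2)).symm
      · rw [indicator_of_notMem hu]
        exact (indicator_of_notMem (s := S) (fun h => hu ⟨h.1, h.2.1⟩) _).symm
    · rw [indicator_of_notMem hv, ← lintegral_zero (μ := (volume : Measure ℝ))]
      refine lintegral_congr fun u => ?_
      exact (indicator_of_notMem (s := S) (fun h => hv ⟨h.1.trans h.2.1, h.2.2⟩) _).symm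
  rw [← lintegral_indicator measurableSet_Ioo, ← lintegral_indicator measurableSet_Ioo]
  simp_rw [hl, hr]
  exact lintegral_lintegral_swap hk.aemeasurable

/-- The renewal identity behind the insertion of self-loops with rate `r`: stopping at the first
self-loop and restarting from there does not change the expectation of a functional with
density `H` and terminal value `w`. -/
lemma setLIntegral_renewal {r : ℝ → ℝ≥0} (hr : Measurable r) {H : ℝ → ℝ≥0∞} (hH : Measurable H)
    (w : ℝ≥0∞) {s T : ℝ} (hsT : s ≤ T) (hfin : ∫⁻ u in Ioo s T, r u ≠ ∞) :
    (∫⁻ u in Ioo s T, expNeg (∫⁻ v in Ioo s u, r v)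
        * (H u + r u * ((∫⁻ v in Ioo u T, H v) + w))) + expNeg (∫⁻ v in Ioo s T, r v) * w
      = (∫⁻ u in Ioo s T, H u) + w := by
  set M : ℝ → ℝ≥0∞ := fun u => expNeg (∫⁻ v in Ioo s u, r v)
  have hM : Measurable M := measurable_expNeg.comp
    (Monotone.measurable fun a b hab => lintegral_mono_set (Ioo_subset_Ioo_right hab))
  have ha : Measurable fun u => r u * M u := hr.coe_nnreal_ennreal.mul hM
  have key : ∀ v ∈ Icc s T, (∫⁻ u in Ioo s v, r u * M u) + M v = 1 := fun v hv =>
    setLIntegral_mul_expNeg_add hr hv.1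
      ((lintegral_mono_set (Ioo_subset_Ioo_right hv.2)).trans_lt hfin.lt_top).ne
  have hHM : Measurable fun u => H u * M u := hH.mul hM
  have h1 : ∀ u, M u * (H u + r u * ((∫⁻ v in Ioo u T, H v) + w))
      = (H u * M u + r u * M u * ∫⁻ v in Ioo u T, H v) + r u * M u * w := fun u => by ring
  change (∫⁻ u in Ioo s T, M u * (H u + r u * ((∫⁻ v in Ioo u T, H v) + w))) + M T * w = _
  simp_rw [h1]
  rw [lintegral_add_right _ (ha.mul_const w), lintegral_add_left hHM,
    lintegral_mul_const _ ha, setLIntegral_mul_setLIntegral_swap ha hH,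
    ← lintegral_add_left hHM, add_assoc]
  rw [← add_mul, key T ⟨hsT, le_rfl⟩, one_mul]
  congr 1
  refine setLIntegral_congr_fun measurableSet_Ioo fun v hv => ?_
  rw [← mul_add, add_comm (M v), key v ⟨hv.1.le, hv.2.le⟩, mul_one]

namespace JumpMechanism

variable {X E : Type*} [Fintype X] [MeasurableSpace X] [DiscreteMeasurableSpace X]
  [Fintype E] {J : JumpMechanism X E}

open Classical in
/-- The rate of events that move the state from `x` to `y`. -/
def transitionRate (J : JumpMechanism X E) (t : ℝ) (x y : X) : ℝ≥0 :=
  ∑ e with J.act x e = y, J.rate t x e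

variable (J) in
lemma transitionRate_eq_sum [DecidableEq X] (t : ℝ) (x y : X) :
    J.transitionRate t x y = ∑ e, if J.act x e = y then J.rate t x e else 0 := by
  rw [transitionRate, Finset.sum_filter]
  congr!

variable (J) in
lemma measurable_transitionRate (x y : X) : Measurable fun t => J.transitionRate t x y :=
  Finset.measurable_sum _ fun e _ => J.measurable_rate x e

variable (J) in
lemma sum_rate_mul (t : ℝ) (x : X) (f : X → ℝ≥0∞) :
    ∑ e, J.rate t x e * f (J.act x e) = ∑ y, J.transitionRate t x y * f y := by
  classical
  rw [← Finset.sum_fiberwise (s := Finset.univ) (g := J.act x)]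
  refine Finset.sum_congr rfl fun y _ => ?_
  rw [transitionRate, ENNReal.ofNNReal_finsetSum, Finset.sum_mul]
  refine Finset.sum_congr ?_ fun e he => by rw [(Finset.mem_filter.1 he).2]
  congr

/-- The mechanism `J'` arises from `J` by adding self-loops: it has the same rates of
transitions between different states, and `J` has no self-loops. -/
structure IsSelfLoopExtension {E' : Type*} [Fintype E'] (J : JumpMechanism X E)
    (J' : JumpMechanism X E') : Prop where
  transitionRate_self : ∀ t x, J.transitionRate t x x = 0
  transitionRate_of_ne : ∀ t x y, y ≠ x → J'.transitionRate t x y = J.transitionRate t x y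

namespace IsSelfLoopExtension

variable {E' : Type*} [Fintype E'] {J' : JumpMechanism X E'} (h : J.IsSelfLoopExtension J')

include h

lemma sum_rate_mul (t : ℝ) (x : X) (f : X → ℝ≥0∞) :
    ∑ e, J'.rate t x e * f (J'.act x e)
      = (∑ e, J.rate t x e * f (J.act x e)) + J'.transitionRate t x x * f x := by
  classical
  rw [J.sum_rate_mul, J'.sum_rate_mul, ← Finset.sum_erase_add _ _ (Finset.mem_univ x),
    ← Finset.sum_erase_add (a := x) (s := Finset.univ)
      (fun y => (J.transitionRate t x y : ℝ≥0∞) * f y) (Finset.mem_univ x),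
    h.transitionRate_self t x]
  simp only [ENNReal.coe_zero, zero_mul, add_zero]
  congr 1
  refine Finset.sum_congr rfl fun y hy => ?_
  rw [h.transitionRate_of_ne t x y (Finset.ne_of_mem_erase hy)]

lemma total_eq (t : ℝ) (x : X) :
    (J'.total t x : ℝ≥0∞) = J.total t x + J'.transitionRate t x x := by
  have := h.sum_rate_mul t x fun _ => 1
  simp only [mul_one, ← ENNReal.ofNNReal_finsetSum] at this
  exact this

lemma cumRate_eq (x : X) (s t : ℝ) :
    J'.cumRate x s t = J.cumRate x s t + ∫⁻ u in Ioo s t, (J'.transitionRate u x x : ℝ≥0∞) := by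
  rw [cumRate, cumRate, ← lintegral_add_left (J.measurable_total x).coe_nnreal_ennreal]
  simp_rw [h.total_eq]

lemma locallyFinite (h' : J'.LocallyFinite) : J.LocallyFinite := fun x s t ht => by
  have := h' x s t ht
  rw [h.cumRate_eq] at this
  exact (ENNReal.add_ne_top.1 this).1

end IsSelfLoopExtension

section Constraint

variable {ι : Type*} [Fintype ι] (τ : ι → ℝ) (y : ι → X)

/-- The constraint that a path which is in the state `x` during `[s, u)` has the value `y i` at
each time `τ i` in `[s, u)`. -/
def Complies (x : X) (s u : ℝ) : Prop := ∀ i, s ≤ τ i → τ i < u → x = y i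

open Classical in
/-- The indicator function of the constraint `Complies`. -/
def compliance (x : X) (s u : ℝ) : ℝ≥0∞ := if Complies τ y x s u then 1 else 0

variable {τ y}

lemma compliance_mul {x : X} {s u v : ℝ} (hsu : s ≤ u) (huv : u ≤ v) :
    compliance τ y x s u * compliance τ y x u v = compliance τ y x s v := by
  have h : Complies τ y x s v ↔ Complies τ y x s u ∧ Complies τ y x u v := by
    refine ⟨fun h => ⟨fun i h1 h2 => h i h1 (h2.trans_le huv),
      fun i h1 h2 => h i (hsu.trans h1) h2⟩, fun h i h1 h2 => ?_⟩
    rcases lt_or_ge (τ i) u with h3 | h3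
    · exact h.1 i h1 h3
    · exact h.2 i h3 h2
  by_cases h1 : Complies τ y x s u <;> by_cases h2 : Complies τ y x u v <;>
    by_cases h3 : Complies τ y x s v <;> first | (exfalso; tauto) | simp [compliance, h1, h2, h3]

lemma compliance_eq_one {x : X} {s u T : ℝ} (hT : ∀ i, τ i ≤ T) (hs : T < s) :
    compliance τ y x s u = 1 :=
  if_pos fun i h _ => absurd (h.trans (hT i)) (not_le.2 hs)

lemma compliance_eq_of_lt {x : X} {s u v T : ℝ} (hT : ∀ i, τ i ≤ T) (hu : T < u) (hv : T < v) :
    compliance τ y x s u = compliance τ y x s v := by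
  have h : Complies τ y x s u ↔ Complies τ y x s v := 
    ⟨fun h i h1 _ => h i h1 ((hT i).trans_lt hu), fun h i h1 _ => h i h1 ((hT i).trans_lt hv)⟩
  by_cases h1 : Complies τ y x s u <;> by_cases h2 : Complies τ y x s v <;>
    first | (exfalso; tauto) | simp [compliance, h1, h2]

lemma measurable_compliance :
    Measurable fun a : (ℝ × X) × (ℝ × X) => compliance τ y a.1.2 a.1.1 a.2.1 := by
  classical
  refine Measurable.ite ?_ measurable_const measurable_const
  have : {a : (ℝ × X) × (ℝ × X) | Complies τ y a.1.2 a.1.1 a.2.1}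
      = ⋂ i, ({a : (ℝ × X) × (ℝ × X) | a.1.1 ≤ τ i}ᶜ ∪ ({a : (ℝ × X) × (ℝ × X) | τ i < a.2.1}ᶜ
        ∪ {a : (ℝ × X) × (ℝ × X) | a.1.2 = y i})) := by
    ext a
    simp only [Complies, mem_iInter, mem_union, mem_compl_iff, mem_ofPred_eq]
    exact forall_congr' fun i => by tauto
  rw [this]
  refine MeasurableSet.iInter fun i => ?_
  refine (measurableSet_le (measurable_fst.comp measurable_fst) measurable_const).compl.union
    ((measurableSet_lt measurable_const (measurable_fst.comp measurable_snd)).compl.union ?_)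
  exact (measurable_snd.comp measurable_fst) (measurableSet_singleton (y i))

lemma measurable_compliance_right (x : X) (s : ℝ) : Measurable (compliance τ y x s) := by
  have h : Measurable ((fun a : (ℝ × X) × (ℝ × X) => compliance τ y a.1.2 a.1.1 a.2.1) ∘
      fun u => ((s, x), (u, x))) := measurable_compliance.comp (by fun_prop)
  exact h

/-- The expectation of `g p q * f q`, where `q` is the outcome of a round started in `p`. -/
def weightedStep (J : JumpMechanism X E) (g : ℝ × X → ℝ × X → ℝ≥0∞) (f : ℝ × X → ℝ≥0∞)
    (p : ℝ × X) : ℝ≥0∞ :=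
  ∫⁻ q, g p q * f q ∂J.step p

lemma measurable_weightedStep {g : ℝ × X → ℝ × X → ℝ≥0∞} {f : ℝ × X → ℝ≥0∞}
    (hg : Measurable (Function.uncurry g)) (hf : Measurable f) :
    Measurable (J.weightedStep g f) :=
  Measurable.lintegral_kernel_prod_right (f := fun p q => g p q * f q)
    (hg.mul (hf.comp measurable_snd))

lemma measurable_iterate_weightedStep {g : ℝ × X → ℝ × X → ℝ≥0∞} {f : ℝ × X → ℝ≥0∞}
    (hg : Measurable (Function.uncurry g)) (hf : Measurable f) (n : ℕ) :
    Measurable ((J.weightedStep g)^[n] f) := by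
  induction n with
  | zero => exact hf
  | succ n ih => rw [Function.iterate_succ_apply']; exact measurable_weightedStep hg ih

lemma weightedStep_mono (g : ℝ × X → ℝ × X → ℝ≥0∞) : Monotone (J.weightedStep g) :=
  fun _ _ hf _ => lintegral_mono fun q => mul_le_mul_right (hf q) _

variable (τ y) in
/-- The expectation over one round of a function `f` of the outcome, on the event that the path
complies with the constraint until the end of the round. -/
def complyStep (J : JumpMechanism X E) (f : ℝ × X → ℝ≥0∞) : ℝ × X → ℝ≥0∞ :=
  J.weightedStep (fun p q => compliance τ y p.2 p.1 q.1) f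

variable {T : ℝ} (hτ : ∀ i, τ i ≤ T) (hT : T < 1)

include hτ hT in
lemma complyStep_eq_one {f : ℝ × X → ℝ≥0∞} (hf : ∀ q, T < q.1 → f q = 1) {p : ℝ × X}
    (hp : T < p.1) : J.complyStep τ y f p = 1 := by
  have : ∀ᵐ q ∂J.step p, compliance τ y p.2 p.1 q.1 * f q = 1 := by
    filter_upwards [J.ae_step_time_mem p] with q hq
    rw [compliance_eq_one hτ hp, hf q ((lt_min hp hT).trans_le hq.1), one_mul]
  rw [complyStep, weightedStep, lintegral_congr_ae this]
  simp

include hτ hT in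
lemma LocallyFinite.complyStep_eq (hJ : J.LocallyFinite) {f : ℝ × X → ℝ≥0∞} (hfm : Measurable f)
    (hf : ∀ q, T < q.1 → f q = 1) (s : ℝ) (x : X) :
    J.complyStep τ y f (s, x)
      = (∫⁻ u in Ioo s T, expNeg (J.cumRate x s u) * (compliance τ y x s u
          * ∑ e, J.rate u x e * f (u, J.act x e)))
        + expNeg (J.cumRate x s T) * compliance τ y x s 1 := by
  have hS : MeasurableSet {q : ℝ × X | q.1 ≤ T} := measurableSet_le measurable_fst measurable_const
  have hm : Measurable fun q : ℝ × X => compliance τ y x s q.1 * f q :=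
    ((measurable_compliance_right x s).comp measurable_fst).mul hfm
  rw [complyStep, weightedStep, ← lintegral_add_compl _ hS]
  congr 1
  · rw [hJ.setLIntegral_step s x hT hm]
    refine lintegral_congr fun u => ?_
    congr 1
    rw [Finset.mul_sum]
    exact Finset.sum_congr rfl fun e _ => by ring
  · have hc : {q : ℝ × X | q.1 ≤ T}ᶜ = {q | T < q.1} := by ext; simp
    rw [hc, ← hJ.step_Ioi s x hT, mul_comm, ← setLIntegral_const]
    refine setLIntegral_congr_fun (hc ▸ hS.compl) fun q hq => ?_
    change compliance τ y x s q.1 * f q = _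
    rw [hf q hq, mul_one]
    exact compliance_eq_of_lt hτ hq hT

include hτ hT in
/-- Functions that are harmonic for a mechanism without self-loops stay harmonic if self-loops
are added. -/
lemma IsSelfLoopExtension.complyStep_eq {E' : Type*} [Fintype E'] {J' : JumpMechanism X E'}
    (h : J.IsSelfLoopExtension J') (hJ' : J'.LocallyFinite) {f : ℝ × X → ℝ≥0∞}
    (hfm : Measurable f) (hf : ∀ q, T < q.1 → f q = 1) (hfix : J.complyStep τ y f = f) :
    J'.complyStep τ y f = f := by
  have hJ := h.locallyFinite hJ'
  funext ⟨s, x⟩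
  rcases lt_or_ge T s with hs | hs
  · rw [complyStep_eq_one hτ hT hf hs, hf _ hs]
  have hfin : ∀ u ≤ T, ∫⁻ v in Ioo s u, (J'.transitionRate v x x : ℝ≥0∞) ≠ ∞ := fun u hu => by
    have := hJ' x s u (hu.trans_lt hT)
    rw [h.cumRate_eq] at this
    exact (ENNReal.add_ne_top.1 this).2
  let G : ℝ → ℝ≥0∞ := fun u => ∑ e, J.rate u x e * f (u, J.act x e)
  have hG : Measurable G := Finset.measurable_sum _ fun e _ =>
    (J.measurable_rate x e).coe_nnreal_ennreal.mul (hfm.comp (by fun_prop))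
  let H : ℝ → ℝ≥0∞ := fun u => expNeg (J.cumRate x s u) * (compliance τ y x s u * G u)
  have hH : Measurable H := (J.measurable_expNeg_cumRate x s).mul
    ((measurable_compliance_right x s).mul hG)
  let w : ℝ≥0∞ := expNeg (J.cumRate x s T) * compliance τ y x s 1
  have hfs : f (s, x) = (∫⁻ u in Ioo s T, H u) + w := by
    conv_lhs => rw [← hfix]
    exact hJ.complyStep_eq hτ hT hfm hf s x
  have hfu : ∀ u ∈ Ioo s T, expNeg (J.cumRate x s u) * (compliance τ y x s u * f (u, x))
      = (∫⁻ v in Ioo u T, H v) + w := by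
    intro u hu
    have hadd : ∀ v ∈ Icc u T, expNeg (J.cumRate x s v)
        = expNeg (J.cumRate x s u) * expNeg (J.cumRate x u v) := fun v hv => by
      rw [J.cumRate_add x hu.1.le hv.1, expNeg_add (hJ _ _ _ (hu.2.trans hT))
        (hJ _ _ _ (hv.2.trans_lt hT))]
    have hfu' : f (u, x) = _ := (congrFun hfix (u, x)).symm.trans
      (hJ.complyStep_eq hτ hT hfm hf u x)
    have hm : Measurable fun v => expNeg (J.cumRate x u v) * (compliance τ y x u v
        * ∑ e, J.rate v x e * f (v, J.act x e)) :=
      (J.measurable_expNeg_cumRate x u).mul ((measurable_compliance_right x u).mul hG)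
    rw [hfu', ← mul_assoc, mul_add, ← lintegral_const_mul _ hm]
    congr 1
    · refine setLIntegral_congr_fun measurableSet_Ioo fun v hv => ?_
      simp only [H]
      rw [hadd v ⟨hv.1.le, hv.2.le⟩, ← compliance_mul hu.1.le hv.1.le]
      ring
    · simp only [w]
      rw [hadd T ⟨hu.2.le, le_rfl⟩, ← compliance_mul hu.1.le (hu.2.trans hT).le]
      ring
  rw [hJ'.complyStep_eq hτ hT hfm hf, hfs,
    ← setLIntegral_renewal (J'.measurable_transitionRate x x) hH w hs (hfin T le_rfl)]
  congr 1
  · refine setLIntegral_congr_fun measurableSet_Ioo fun u hu => ?_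
    rw [← hfu u hu, h.cumRate_eq, expNeg_add (hJ _ _ _ (hu.2.trans hT)) (hfin u hu.2.le),
      h.sum_rate_mul u x fun z => f (u, z)]
    simp only [H, G]
    ring
  · rw [h.cumRate_eq, expNeg_add (hJ _ _ _ hT) (hfin T le_rfl)]
    simp only [w]
    ring

/-- The probability that the simulation started in `p` reaches a time beyond `T` within `n` rounds
and complies with the constraint. -/
def complyProb (J : JumpMechanism X E) (τ : ι → ℝ) (y : ι → X) (T : ℝ) (n : ℕ) :
    ℝ × X → ℝ≥0∞ :=
  (J.complyStep τ y)^[n] ({q : ℝ × X | T < q.1}.indicator 1)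

variable (J τ y T) in
lemma complyProb_succ (n : ℕ) :
    J.complyProb τ y T (n + 1) = J.complyStep τ y (J.complyProb τ y T n) :=
  Function.iterate_succ_apply' _ _ _

variable (J τ y T) in
lemma measurable_complyProb (n : ℕ) : Measurable (J.complyProb τ y T n) :=
  measurable_iterate_weightedStep measurable_compliance
    (measurable_one.indicator (measurableSet_lt measurable_const measurable_fst)) n

include hτ hT in
lemma complyProb_eq_one (n : ℕ) {q : ℝ × X} (hq : T < q.1) : J.complyProb τ y T n q = 1 := by
  induction n generalizing q with
  | zero => exact indicator_of_mem (s := {q : ℝ × X | T < q.1}) hq 1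
  | succ n ih =>
    rw [complyProb_succ]
    exact complyStep_eq_one hτ hT (fun q hq => ih hq) hq

include hτ hT in
lemma monotone_complyProb : Monotone (J.complyProb τ y T) := by
  refine monotone_nat_of_le_succ fun n => ?_
  induction n with
  | zero =>
    intro q
    by_cases hq : T < q.1
    · rw [complyProb_eq_one hτ hT _ hq, complyProb_eq_one hτ hT _ hq]
    · rw [complyProb, Function.iterate_zero, id_eq, indicator_of_notMem (by simpa using hq)]
      exact zero_le
  | succ n ih =>
    rw [complyProb_succ, complyProb_succ J τ y T (n + 1)]
    exact weightedStep_mono _ ih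

include hτ hT in
/-- Adding self-loops does not increase the limit of the probabilities of compliance. -/
lemma IsSelfLoopExtension.complyProb_le {E' : Type*} [Fintype E'] {J' : JumpMechanism X E'}
    (h : J.IsSelfLoopExtension J') (hJ' : J'.LocallyFinite) (n : ℕ) :
    J'.complyProb τ y T n ≤ fun p => ⨆ m, J.complyProb τ y T m p := by
  set f : ℝ × X → ℝ≥0∞ := fun p => ⨆ m, J.complyProb τ y T m p with hfdef
  have hfm : Measurable f := Measurable.iSup fun m => J.measurable_complyProb τ y T m
  have hf : ∀ q, T < q.1 → f q = 1 := fun q hq => by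
    simp [hfdef, complyProb_eq_one hτ hT _ hq]
  have hmono := monotone_complyProb (J := J) (y := y) hτ hT
  have hfix : J.complyStep τ y f = f := by
    funext p
    have h1 : J.complyStep τ y f p = ⨆ m, J.complyStep τ y (J.complyProb τ y T m) p := by
      simp only [complyStep, weightedStep, hfdef, ENNReal.mul_iSup]
      refine lintegral_iSup (fun m => ?_) fun m k hmk q => mul_le_mul_right (hmono hmk q) _
      exact ((measurable_compliance_right p.2 p.1).comp measurable_fst).mul
        (J.measurable_complyProb τ y T m)
    rw [h1]
    simp_rw [← complyProb_succ]
    exact Monotone.iSup_nat_add (f := fun m => J.complyProb τ y T m p)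
      (fun m k hmk => hmono hmk p) 1
  have hfix' := h.complyStep_eq hτ hT hJ' hfm hf hfix
  induction n with
  | zero =>
    intro p
    exact le_iSup_of_le 0 le_rfl
  | succ n ih =>
    rw [complyProb_succ, ← hfix']
    exact weightedStep_mono _ ih

end Constraint

end JumpMechanism

namespace JumpMechanism

variable {X E : Type*} [Fintype X] [MeasurableSpace X] [DiscreteMeasurableSpace X]
  [Fintype E] (J : JumpMechanism X E) (p₀ : PMF X)

/-- The Markov property of the simulated chain. -/
lemma lintegral_chainLaw_step (n : ℕ)
    {Ψ : ((i : Finset.Iic n) → ℝ × X) × (ℝ × X) → ℝ≥0∞} (hΨ : Measurable Ψ) :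
    ∫⁻ h, Ψ (Preorder.frestrictLe n h, h (n + 1)) ∂J.chainLaw p₀
      = ∫⁻ h, ∫⁻ q, Ψ (Preorder.frestrictLe n h, q) ∂J.step (h n) ∂J.chainLaw p₀ := by
  have : IsProbabilityMeasure (p₀.toMeasure.map fun x => ((0 : ℝ), x)) :=
    Measure.isProbabilityMeasure_map (by fun_prop)
  have key := Kernel.map_frestrictLe_trajMeasure_compProd_eq_map_trajMeasure
    (X := fun _ => ℝ × X) (μ₀ := p₀.toMeasure.map fun x => ((0 : ℝ), x))
    (κ := J.historyKernel) (a := n)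
  have h1 := congrArg (fun μ => ∫⁻ a, Ψ a ∂μ) key
  rw [Measure.lintegral_compProd hΨ, lintegral_map hΨ (by fun_prop),
    lintegral_map (Measurable.lintegral_kernel_prod_right' hΨ) (by fun_prop)] at h1
  exact h1.symm

lemma map_eval_zero_chainLaw :
    (J.chainLaw p₀).map (fun h => h 0) = p₀.toMeasure.map fun x => ((0 : ℝ), x) := by
  have : IsProbabilityMeasure (p₀.toMeasure.map fun x => ((0 : ℝ), x)) :=
    Measure.isProbabilityMeasure_map (by fun_prop)
  have h : (fun h : ℕ → ℝ × X => h 0)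
      = (MeasurableEquiv.piUnique fun i : Finset.Iic 0 => ℝ × X) ∘ Preorder.frestrictLe 0 := by
    funext h; rfl
  rw [h, ← Measure.map_map (by fun_prop) (by fun_prop), chainLaw, Kernel.trajMeasure,
    Measure.map_comp _ _ (by fun_prop), Kernel.traj_map_frestrictLe, Kernel.partialTraj_self,
    Measure.id_comp, Measure.map_map (by fun_prop) (by fun_prop)]
  exact (congrArg (Measure.map · _) (MeasurableEquiv.self_comp_symm _)).trans Measure.map_id

lemma lintegral_eval_zero_chainLaw {f : ℝ × X → ℝ≥0∞} (hf : Measurable f) :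
    ∫⁻ h, f (h 0) ∂J.chainLaw p₀ = ∫⁻ x, f (0, x) ∂p₀.toMeasure := by
  rw [← lintegral_map hf (by fun_prop), map_eval_zero_chainLaw, lintegral_map hf (by fun_prop)]

lemma lintegral_chainLaw_prod {g : ℝ × X → ℝ × X → ℝ≥0∞} (hg : Measurable (Function.uncurry g))
    {f : ℝ × X → ℝ≥0∞} (hf : Measurable f) (n : ℕ) :
    ∫⁻ h, (∏ i ∈ Finset.range n, g (h i) (h (i + 1))) * f (h n) ∂J.chainLaw p₀
      = ∫⁻ x, (J.weightedStep g)^[n] f (0, x) ∂p₀.toMeasure := by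
  induction n generalizing f with
  | zero => simpa using lintegral_eval_zero_chainLaw J p₀ hf
  | succ n ih =>
    rw [Function.iterate_succ_apply, ← ih (measurable_weightedStep hg hf)]
    let P : ((i : Finset.Iic n) → ℝ × X) → ℝ≥0∞ := fun z => ∏ i : Fin n,
      g (z ⟨i, Finset.mem_Iic.2 i.2.le⟩) (z ⟨i + 1, Finset.mem_Iic.2 i.2⟩)
    have hP : Measurable P := Finset.measurable_prod _ fun i _ =>
      hg.comp (f := fun z : (i : Finset.Iic n) → ℝ × X =>
          (z ⟨i, Finset.mem_Iic.2 i.2.le⟩, z ⟨i + 1, Finset.mem_Iic.2 i.2⟩))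
        ((measurable_pi_apply _).prodMk (measurable_pi_apply _))
    have hPr : ∀ h : ℕ → ℝ × X, P (Preorder.frestrictLe n h)
        = ∏ i ∈ Finset.range n, g (h i) (h (i + 1)) := fun h =>
      (Finset.prod_range fun i => g (h i) (h (i + 1))).symm
    let Ψ : ((i : Finset.Iic n) → ℝ × X) × (ℝ × X) → ℝ≥0∞ := fun a =>
      P a.1 * (g (a.1 ⟨n, Finset.mem_Iic.2 le_rfl⟩) a.2 * f a.2)
    have hΨ : Measurable Ψ := by
      refine (hP.comp measurable_fst).mul (Measurable.mul ?_ (hf.comp measurable_snd))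
      exact hg.comp (f := fun a : ((i : Finset.Iic n) → ℝ × X) × (ℝ × X) =>
          (a.1 ⟨n, Finset.mem_Iic.2 le_rfl⟩, a.2))
        (((measurable_pi_apply _).comp measurable_fst).prodMk measurable_snd)
    have hl : ∀ h : ℕ → ℝ × X, (∏ i ∈ Finset.range (n + 1), g (h i) (h (i + 1))) * f (h (n + 1))
        = Ψ (Preorder.frestrictLe n h, h (n + 1)) := fun h => by
      rw [Finset.prod_range_succ, ← hPr, mul_assoc]; rfl
    simp_rw [hl]
    rw [J.lintegral_chainLaw_step p₀ n hΨ]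
    refine lintegral_congr fun h => ?_
    rw [← hPr, weightedStep, ← lintegral_const_mul]
    · rfl
    · exact (hg.comp measurable_prodMk_left).mul hf

lemma ae_chainLaw_time :
    ∀ᵐ h ∂J.chainLaw p₀, (h 0).1 = 0 ∧ ∀ n, (h n).1 ≤ (h (n + 1)).1 := by
  have h0 : ∀ᵐ h ∂J.chainLaw p₀, (h 0).1 = 0 := by
    have h1 : ∀ᵐ q ∂(J.chainLaw p₀).map (fun h => h 0), q.1 = 0 := by
      rw [map_eval_zero_chainLaw]
      exact (ae_map_iff (by fun_prop) (measurable_fst (measurableSet_singleton (0 : ℝ)))).2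
        (Filter.Eventually.of_forall fun _ => rfl)
    exact ae_of_ae_map (measurable_pi_apply 0).aemeasurable h1
  have hs : ∀ n, ∀ᵐ h ∂J.chainLaw p₀, min (h n).1 1 ≤ (h (n + 1)).1 ∧ (h (n + 1)).1 ≤ 1 := by
    intro n
    let S : Set (((i : Finset.Iic n) → ℝ × X) × (ℝ × X)) :=
      {a | min (a.1 ⟨n, Finset.mem_Iic.2 le_rfl⟩).1 1 ≤ a.2.1 ∧ a.2.1 ≤ 1}
    have hS : MeasurableSet S := by
      have hfst : Measurable fun a : ((i : Finset.Iic n) → ℝ × X) × (ℝ × X) =>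
          (a.1 ⟨n, Finset.mem_Iic.2 le_rfl⟩).1 :=
        measurable_fst.comp ((measurable_pi_apply _).comp measurable_fst)
      have hsnd : Measurable fun a : ((i : Finset.Iic n) → ℝ × X) × (ℝ × X) => a.2.1 :=
        measurable_fst.comp measurable_snd
      exact (measurableSet_le (hfst.min measurable_const) hsnd).inter
        (measurableSet_le hsnd measurable_const)
    let Ψ : ((i : Finset.Iic n) → ℝ × X) × (ℝ × X) → ℝ≥0∞ := Sᶜ.indicator 1
    have hΨ : Measurable Ψ := measurable_one.indicator hS.compl
    have hz := J.lintegral_chainLaw_step p₀ n hΨ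
    have hr : ∀ h : ℕ → ℝ × X,
        ∫⁻ q, Ψ (Preorder.frestrictLe n h, q) ∂J.step (h n) = 0 := by
      intro h
      refine (lintegral_eq_zero_iff (f := fun q => Ψ (Preorder.frestrictLe n h, q))
        (hΨ.comp measurable_prodMk_left)).2 ?_
      filter_upwards [J.ae_step_time_mem (h n)] with q hq
      exact indicator_of_notMem (s := Sᶜ) (fun hc => hc hq) _
    simp_rw [hr] at hz
    have hm : Measurable fun h : ℕ → ℝ × X => Ψ (Preorder.frestrictLe n h, h (n + 1)) :=
      hΨ.comp (by fun_prop)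
    rw [lintegral_zero, lintegral_eq_zero_iff hm] at hz
    filter_upwards [hz] with h hh
    by_contra hc
    have h1 : Ψ (Preorder.frestrictLe n h, h (n + 1)) = 1 :=
      indicator_of_mem (s := Sᶜ) (a := (Preorder.frestrictLe n h, h (n + 1))) hc 1
    exact one_ne_zero (h1.symm.trans hh)
  filter_upwards [h0, ae_all_iff.2 hs] with h h1 h2
  refine ⟨h1, fun n => ?_⟩
  have hn : (h n).1 ≤ 1 := by
    cases n with
    | zero => rw [h1]; exact zero_le_one
    | succ n => exact (h2 n).2
  simpa [min_eq_left hn] using (h2 n).1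

/-- The simulated chain does not explode before time `1`. -/
lemma LocallyFinite.tendsto_chainLaw_time_le {J : JumpMechanism X E} (hJ : J.LocallyFinite)
    {T : ℝ} (hT : T < 1) :
    Filter.Tendsto (fun n => J.chainLaw p₀ {h | (h n).1 ≤ T}) Filter.atTop (nhds 0) := by
  have hVm := J.measurable_lyapunov T
  have hit : ∀ n p, (J.weightedStep 1)^[n] (J.lyapunov T) p ≤ 2⁻¹ ^ n * J.lyapunov T p := by
    intro n
    induction n with
    | zero => simp
    | succ n ih =>
      intro p
      rw [Function.iterate_succ_apply']
      refine (weightedStep_mono 1 ih p).trans ?_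
      simp only [weightedStep, Pi.one_apply, one_mul]
      rw [lintegral_const_mul _ hVm, pow_succ, mul_assoc]
      gcongr
      exact hJ.lintegral_lyapunov_le hT p
  let C : ℝ≥0∞ := ∫⁻ x, J.lyapunov T (0, x) ∂p₀.toMeasure
  have hC : C ≠ ∞ := by
    have hle : ∀ x, J.lyapunov T (0, x)
        ≤ ENNReal.ofReal (Real.exp (∑ x, (J.cumRate x 0 T).toReal)) := fun x =>
      indicator_le_self' (s := {q : ℝ × X | q.1 ≤ T}) (fun _ _ => zero_le) _
    have : C ≤ _ := lintegral_mono hle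
    refine (this.trans_lt ?_).ne
    simp
  have hbound : ∀ n, J.chainLaw p₀ {h | (h n).1 ≤ T} ≤ 2⁻¹ ^ n * C := by
    intro n
    have hle : ∀ h : ℕ → ℝ × X, {h : ℕ → ℝ × X | (h n).1 ≤ T}.indicator 1 h
        ≤ J.lyapunov T (h n) := by
      intro h
      by_cases hh : (h n).1 ≤ T
      · rw [indicator_of_mem (s := {h : ℕ → ℝ × X | (h n).1 ≤ T}) hh]
        exact one_le_lyapunov hh
      · rw [indicator_of_notMem (s := {h : ℕ → ℝ × X | (h n).1 ≤ T}) hh]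
        exact zero_le
    have hprod := J.lintegral_chainLaw_prod p₀ (g := 1) measurable_one hVm n
    simp only [Pi.one_apply, Finset.prod_const_one, one_mul] at hprod
    have hS : MeasurableSet {h : ℕ → ℝ × X | (h n).1 ≤ T} :=
      measurableSet_le (by fun_prop) measurable_const
    rw [← lintegral_indicator_one hS]
    refine (lintegral_mono hle).trans ?_
    have hm : Measurable fun x => J.lyapunov T (0, x) := Measurable.of_discrete
    rw [hprod, ← lintegral_const_mul _ hm]
    exact lintegral_mono fun x => hit n (0, x)
  have hlim : Filter.Tendsto (fun n : ℕ => (2⁻¹ : ℝ≥0∞) ^ n * C) Filter.atTop (nhds 0) := by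
    have := ENNReal.Tendsto.mul_const (b := C) (ENNReal.tendsto_pow_atTop_nhds_zero_of_lt_one
      (r := 2⁻¹) (ENNReal.inv_lt_one.2 ENNReal.one_lt_two)) (Or.inr hC)
    simpa using this
  exact tendsto_of_tendsto_of_tendsto_of_le_of_le tendsto_const_nhds hlim (fun _ => zero_le) hbound

section Constraint

variable {ι : Type*} [Fintype ι] (τ : ι → ℝ) (y : ι → X) (T : ℝ)

/-- The event that the chain reaches a time beyond `T` within `n` rounds and complies with the
constraint in each of them. -/
def complyEvent (n : ℕ) : Set (ℕ → ℝ × X) :=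
  {h | T < (h n).1 ∧ ∀ i < n, Complies τ y (h i).2 (h i).1 (h (i + 1)).1}

lemma measurableSet_complyEvent (n : ℕ) : MeasurableSet (complyEvent τ y T n) := by
  have h1 : MeasurableSet {h : ℕ → ℝ × X | T < (h n).1} :=
    measurableSet_lt measurable_const (by fun_prop)
  have h2 : ∀ i, MeasurableSet {h : ℕ → ℝ × X | Complies τ y (h i).2 (h i).1 (h (i + 1)).1} := by
    intro i
    have hm : Measurable ((fun a : (ℝ × X) × (ℝ × X) => compliance τ y a.1.2 a.1.1 a.2.1) ∘
        fun h : ℕ → ℝ × X => (h i, h (i + 1))) := measurable_compliance.comp (by fun_prop)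
    convert hm (measurableSet_singleton 1) using 1
    ext h
    simp [compliance]
  have : complyEvent τ y T n = {h : ℕ → ℝ × X | T < (h n).1} ∩
      ⋂ i ∈ Iio n, {h : ℕ → ℝ × X | Complies τ y (h i).2 (h i).1 (h (i + 1)).1} := by
    ext h; simp [complyEvent]
  rw [this]
  exact h1.inter (MeasurableSet.biInter (to_countable _) fun i _ => h2 i)

lemma chainLaw_complyEvent (n : ℕ) :
    J.chainLaw p₀ (complyEvent τ y T n) = ∫⁻ x, J.complyProb τ y T n (0, x) ∂p₀.toMeasure := by
  classical
  rw [← lintegral_indicator_one (measurableSet_complyEvent τ y T n)]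
  have := J.lintegral_chainLaw_prod p₀ (g := fun p q => compliance τ y p.2 p.1 q.1)
    measurable_compliance (f := {q : ℝ × X | T < q.1}.indicator 1)
    (measurable_one.indicator (measurableSet_lt measurable_const measurable_fst)) n
  refine Eq.trans (lintegral_congr fun h => ?_) this
  by_cases hT : T < (h n).1
  · rw [indicator_of_mem (s := {q : ℝ × X | T < q.1}) hT]
    simp only [compliance, Finset.prod_ite_zero, Finset.mem_range, Finset.prod_const_one,
      Pi.one_apply, mul_one]
    by_cases hc : ∀ i < n, Complies τ y (h i).2 (h i).1 (h (i + 1)).1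
    · rw [if_pos hc, indicator_of_mem (s := complyEvent τ y T n) ⟨hT, hc⟩]; rfl
    · rw [if_neg hc, indicator_of_notMem (s := complyEvent τ y T n) fun hh => hc hh.2]
  · rw [indicator_of_notMem (s := {q : ℝ × X | T < q.1}) hT, mul_zero,
      indicator_of_notMem (s := complyEvent τ y T n) fun hh => hT hh.1]

end Constraint

end JumpMechanism

section Path

variable {X : Type*} {ι : Type*} {τ : ι → Ico (0 : ℝ) 1} {y : ι → X} {T : ℝ}

open JumpMechanism

lemma pathOf_eq_of_mem_complyEvent (hτ : ∀ i, (τ i : ℝ) ≤ T) {n : ℕ} {h : ℕ → ℝ × X}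
    (h0 : (h 0).1 = 0) (hn : T < (h n).1)
    (hc : ∀ i < n, Complies (fun i => (τ i : ℝ)) y (h i).2 (h i).1 (h (i + 1)).1) (i : ι) :
    pathOf h (τ i) = y i := by
  have hlt : (τ i : ℝ) < (h n).1 := (hτ i).trans_lt hn
  obtain ⟨m, rfl⟩ : ∃ m, n = m + 1 := by
    refine Nat.exists_eq_succ_of_ne_zero fun hz => ?_
    rw [hz, h0] at hlt
    exact absurd (τ i).2.1 (not_le.2 hlt)
  have hne : {k | (τ i : ℝ) < (h (k + 1)).1}.Nonempty := ⟨m, hlt⟩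
  have hmem : (τ i : ℝ) < (h (jumpCount h (τ i) + 1)).1 := Nat.sInf_mem hne
  have hle : jumpCount h (τ i) ≤ m := Nat.sInf_le hlt
  refine hc _ (Nat.lt_succ_of_le hle) i ?_ hmem
  rcases Nat.eq_zero_or_pos (jumpCount h (τ i)) with hz | hpos
  · change (h (jumpCount h (τ i))).1 ≤ τ i
    rw [hz, h0]
    exact (τ i).2.1
  · obtain ⟨k, hk⟩ := Nat.exists_eq_succ_of_ne_zero hpos.ne'
    have hk' : k ∉ {k | (τ i : ℝ) < (h (k + 1)).1} :=
      Nat.notMem_of_lt_sInf (show k < jumpCount h (τ i) by omega)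
    change (h (jumpCount h (τ i))).1 ≤ τ i
    rw [hk]
    exact not_lt.1 hk'

lemma complies_of_pathOf_eq {h : ℕ → ℝ × X} (hmono : ∀ n, (h n).1 ≤ (h (n + 1)).1)
    (hy : ∀ i, pathOf h (τ i) = y i) (n : ℕ) :
    Complies (fun i => (τ i : ℝ)) y (h n).2 (h n).1 (h (n + 1)).1 := by
  intro i h1 h2
  have hmono' : Monotone fun n => (h n).1 := monotone_nat_of_le_succ hmono
  have hcount : jumpCount h (τ i) = n := by
    refine le_antisymm (Nat.sInf_le h2) (le_csInf ⟨n, h2⟩ fun k hk => ?_)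
    by_contra! hkn
    exact absurd (hk.trans_le (hmono' (Nat.succ_le_of_lt hkn))) (not_lt.2 h1)
  rw [← hy i, pathOf, hcount]

end Path

namespace JumpMechanism

variable {X E : Type*} [Fintype X] [MeasurableSpace X] [DiscreteMeasurableSpace X]
  [Fintype E] {J : JumpMechanism X E} (p₀ : PMF X)
  {E' : Type*} [Fintype E'] {J' : JumpMechanism X E'}

lemma IsSelfLoopExtension.trajectoryLaw_cylinder_le (h : J.IsSelfLoopExtension J')
    (hJ' : J'.LocallyFinite) {ι : Type*} [Finite ι] (τ : ι → Ico (0 : ℝ) 1) (y : ι → X) :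
    J'.trajectoryLaw p₀ {ω | ∀ i, ω (τ i) = y i} ≤ J.trajectoryLaw p₀ {ω | ∀ i, ω (τ i) = y i} := by
  have := Fintype.ofFinite ι
  obtain ⟨T, hT, hτ⟩ : ∃ T < (1 : ℝ), ∀ i, (τ i : ℝ) ≤ T := by
    rcases isEmpty_or_nonempty ι with hι | hι
    · exact ⟨0, zero_lt_one, fun i => hι.elim i⟩
    · obtain ⟨i, hi⟩ := Finite.exists_max fun i => (τ i : ℝ)
      exact ⟨τ i, (τ i).2.2, hi⟩
  have hS : MeasurableSet {ω : Ico (0 : ℝ) 1 → X | ∀ i, ω (τ i) = y i} := by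
    have : {ω : Ico (0 : ℝ) 1 → X | ∀ i, ω (τ i) = y i} = ⋂ i, {ω | ω (τ i) = y i} := by
      ext; simp
    rw [this]
    exact MeasurableSet.iInter fun i =>
      measurableSet_eq_fun (measurable_pi_apply (τ i)) measurable_const
  rw [trajectoryLaw, trajectoryLaw, Measure.map_apply measurable_pathOf hS,
    Measure.map_apply measurable_pathOf hS]
  set A : Set (ℕ → ℝ × X) := pathOf ⁻¹' {ω | ∀ i, ω (τ i) = y i}
  have hlower : ∀ n, ∫⁻ x, J.complyProb (fun i => (τ i : ℝ)) y T n (0, x) ∂p₀.toMeasure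
      ≤ J.chainLaw p₀ A := by
    intro n
    rw [← chainLaw_complyEvent]
    refine measure_mono_ae ?_
    filter_upwards [J.ae_chainLaw_time p₀] with ω hω hω'
    exact fun i => pathOf_eq_of_mem_complyEvent hτ hω.1 hω'.1 hω'.2 i
  have hupper : ∀ n, J'.chainLaw p₀ A
      ≤ J.chainLaw p₀ A + J'.chainLaw p₀ {h | (h n).1 ≤ T} := by
    intro n
    have h1 : J'.chainLaw p₀ A
        ≤ J'.chainLaw p₀ (complyEvent (fun i => (τ i : ℝ)) y T n ∪ {h | (h n).1 ≤ T}) := by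
      refine measure_mono_ae ?_
      filter_upwards [J'.ae_chainLaw_time p₀] with ω hω hω'
      rcases le_or_gt (ω n).1 T with hn | hn
      · exact Or.inr hn
      · exact Or.inl ⟨hn, fun i _ => complies_of_pathOf_eq hω.2 hω' i⟩
    refine h1.trans ((measure_union_le _ _).trans (add_le_add_left ?_ _))
    rw [chainLaw_complyEvent]
    have hmono := monotone_complyProb (J := J) (y := y) hτ hT
    calc ∫⁻ x, J'.complyProb (fun i => (τ i : ℝ)) y T n (0, x) ∂p₀.toMeasure
        ≤ ∫⁻ x, ⨆ m, J.complyProb (fun i => (τ i : ℝ)) y T m (0, x) ∂p₀.toMeasure :=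
          lintegral_mono fun x => h.complyProb_le hτ hT hJ' n (0, x)
      _ = ⨆ m, ∫⁻ x, J.complyProb (fun i => (τ i : ℝ)) y T m (0, x) ∂p₀.toMeasure :=
          lintegral_iSup (fun m => Measurable.of_discrete) fun m k hmk x => hmono hmk (0, x)
      _ ≤ J.chainLaw p₀ A := iSup_le hlower
  have hlim := (hJ'.tendsto_chainLaw_time_le p₀ hT).const_add (J.chainLaw p₀ A)
  rw [add_zero] at hlim
  exact ge_of_tendsto' hlim hupper

/-- Adding self-loops does not change the distribution over trajectories. -/
theorem IsSelfLoopExtension.trajectoryLaw_eq (h : J.IsSelfLoopExtension J')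
    (hJ' : J'.LocallyFinite) : J.trajectoryLaw p₀ = J'.trajectoryLaw p₀ := by
  have hI : ∀ I : Finset (Ico (0 : ℝ) 1), (J'.trajectoryLaw p₀).map I.restrict
      = (J.trajectoryLaw p₀).map I.restrict := by
    intro I
    have hm : Measurable (I.restrict : (Ico (0 : ℝ) 1 → X) → I → X) := by fun_prop
    have := Measure.isProbabilityMeasure_map (μ := J.trajectoryLaw p₀) hm.aemeasurable
    have := Measure.isProbabilityMeasure_map (μ := J'.trajectoryLaw p₀) hm.aemeasurable
    refine Measure.eq_of_le_of_isProbabilityMeasure ?_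
    have hsing : ∀ y : I → X, (J'.trajectoryLaw p₀).map I.restrict {y}
        ≤ (J.trajectoryLaw p₀).map I.restrict {y} := by
      intro y
      rw [Measure.map_apply hm (measurableSet_singleton y),
        Measure.map_apply hm (measurableSet_singleton y)]
      have hS : (I.restrict : (Ico (0 : ℝ) 1 → X) → I → X) ⁻¹' {y}
          = {ω | ∀ i : I, ω i = y i} := by
        ext ω
        exact funext_iff
      rw [hS]
      exact h.trajectoryLaw_cylinder_le p₀ hJ' (fun i : I => (i : Ico (0 : ℝ) 1)) y
    refine Measure.le_iff.2 fun s _ => ?_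
    have hd : s.PairwiseDisjoint fun y : I → X => ({y} : Set (I → X)) :=
      pairwiseDisjoint_fiber id s
    rw [← Set.biUnion_of_singleton s,
      measure_biUnion (to_countable s) hd fun y _ => measurableSet_singleton y,
      measure_biUnion (to_countable s) hd fun y _ => measurableSet_singleton y]
    exact ENNReal.tsum_le_tsum fun y => hsing y
  have h1 : IsProjectiveLimit (J'.trajectoryLaw p₀)
      fun I : Finset (Ico (0 : ℝ) 1) => (J.trajectoryLaw p₀).map I.restrict := hI
  exact IsProjectiveLimit.unique (P := fun I => (J.trajectoryLaw p₀).map I.restrict)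
    (fun I => rfl) h1

end JumpMechanism

namespace PlannerDenoiser

variable {D S : ℕ} (M : PlannerDenoiser D S)

lemma isSelfLoopExtension : M.ctmc.IsSelfLoopExtension M.selfLoop where
  transitionRate_self t x := by
    rw [M.ctmc.transitionRate_eq_sum]
    refine Finset.sum_eq_zero fun y _ => ?_
    by_cases h : y = x <;> simp [ctmc, ctmcMechanism, h]
  transitionRate_of_ne t x y hyx := by
    have hc : M.ctmc.transitionRate t x y = (M.offDiagRate t x y).toNNReal := by
      rw [M.ctmc.transitionRate_eq_sum]
      simp [ctmc, ctmcMechanism, rateMatrix, hyx]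
    rw [hc, offDiagRate, ← Fintype.sum_prod_type' (f := fun d j =>
        if j ≠ x d ∧ Function.update x d j = y then M.jumpRate t x d j else 0),
      Real.toNNReal_sum_of_nonneg, M.selfLoop.transitionRate_eq_sum]
    · refine Finset.sum_congr rfl fun e _ => ?_
      have hiff : (e.2 ≠ x e.1 ∧ Function.update x e.1 e.2 = y)
          ↔ Function.update x e.1 e.2 = y := by
        refine and_iff_right_of_imp fun hu he => hyx ?_
        rw [← hu, he, Function.update_eq_self]
      by_cases h : Function.update x e.1 e.2 = y
      · rw [if_pos (hiff.2 h)]; exact if_pos h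
      · rw [if_neg fun h' => h (hiff.1 h'), Real.toNNReal_zero]; exact if_neg h
    · intro e _
      split_ifs
      · exact M.jumpRate_nonneg t x e.1 e.2
      · exact le_rfl

lemma sum_jumpRate (t : ℝ) (x : Fin D → Fin S) (d : Fin D) :
    ∑ j, M.jumpRate t x d j = M.noiseRate t * M.planner t x d := by
  simp only [jumpRate]
  rw [← Finset.mul_sum, M.sum_denoiser, mul_one]

lemma coe_selfLoop_rate (t : ℝ) (x : Fin D → Fin S) (e : Fin D × Fin S) :
    (M.selfLoop.rate t x e : ℝ) = M.jumpRate t x e.1 e.2 :=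
  Real.coe_toNNReal _ (M.jumpRate_nonneg t x e.1 e.2)

lemma coe_selfLoop_total (t : ℝ) (x : Fin D → Fin S) :
    (M.selfLoop.total t x : ℝ) = M.noiseRate t * ∑ d, M.planner t x d := by
  rw [JumpMechanism.total, NNReal.coe_sum]
  simp_rw [coe_selfLoop_rate]
  rw [Fintype.sum_prod_type, Finset.mul_sum]
  exact Finset.sum_congr rfl fun d _ => M.sum_jumpRate t x d

lemma selfLoop_total_le (t : ℝ) (x : Fin D → Fin S) :
    (M.selfLoop.total t x : ℝ≥0∞) ≤ D * ENNReal.ofReal (M.noiseRate t) := by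
  rw [← ENNReal.ofReal_coe_nnreal, coe_selfLoop_total, ← ENNReal.ofReal_natCast,
    ← ENNReal.ofReal_mul (Nat.cast_nonneg D), mul_comm (D : ℝ)]
  refine ENNReal.ofReal_le_ofReal (mul_le_mul_of_nonneg_left ?_ (M.noiseRate_nonneg t))
  refine (Finset.sum_le_sum fun d _ => (M.planner_mem t x d).2).trans ?_
  simp

lemma lintegral_noiseRate_ne_top (s : ℝ) {t : ℝ} (ht : t < 1) :
    ∫⁻ u in Ioo s t, ENNReal.ofReal (M.noiseRate u) ≠ ∞ := by
  have h0 : ∀ u ∉ Ico (0 : ℝ) 1, M.noiseRate u = 0 := fun u hu => indicator_of_notMem hu _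
  let b := max t 0
  have hb1 : b < 1 := max_lt ht zero_lt_one
  have hb0 : 0 ≤ b := le_max_right _ _
  have hsub : Icc 0 b ⊆ Ico (0 : ℝ) 1 := fun u hu => ⟨hu.1, hu.2.trans_lt hb1⟩
  have hint : IntegrableOn (deriv M.α) (Ioo 0 b) := by
    rw [← intervalIntegrable_iff_integrableOn_Ioo_of_le hb0]
    refine MonotoneOn.intervalIntegrable_deriv ?_
    rw [uIcc_of_le hb0]
    exact M.monotoneOn_α.mono hsub
  have hfin : ∫⁻ u in Ioo 0 b, ENNReal.ofReal (1 - M.α b)⁻¹ * ‖deriv M.α u‖ₑ ≠ ∞ := by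
    rw [lintegral_const_mul' _ _ ENNReal.ofReal_ne_top]
    exact ENNReal.mul_ne_top ENNReal.ofReal_ne_top hint.2.ne
  refine ne_top_of_le_ne_top hfin ?_
  have hle : ∀ u ∈ Ioo (0 : ℝ) b, ENNReal.ofReal (M.noiseRate u)
      ≤ ENNReal.ofReal (1 - M.α b)⁻¹ * ‖deriv M.α u‖ₑ := by
    intro u hu
    have hu1 : u ∈ Ico (0 : ℝ) 1 := hsub (Ioo_subset_Icc_self hu)
    have hbI : b ∈ Ico (0 : ℝ) 1 := ⟨hb0, hb1⟩
    have hα : M.α u ≤ M.α b := M.monotoneOn_α hu1 hbI hu.2.le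
    have hpos : 0 < 1 - M.α b := sub_pos.2 (M.α_lt_one b hbI)
    have hd : derivWithin M.α (Ico 0 1) u = deriv M.α u :=
      derivWithin_of_mem_nhds (Ico_mem_nhds hu.1 hu1.2)
    have hd0 : 0 ≤ deriv M.α u := hd ▸ M.monotoneOn_α.derivWithin_nonneg
    rw [noiseRate, indicator_of_mem hu1, hd, Real.enorm_eq_ofReal hd0,
      ← ENNReal.ofReal_mul (inv_nonneg.2 hpos.le), div_eq_mul_inv, mul_comm]
    refine ENNReal.ofReal_le_ofReal (mul_le_mul_of_nonneg_right ?_ hd0)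
    exact inv_anti₀ hpos (by linarith)
  refine le_trans ?_ (setLIntegral_mono' measurableSet_Ioo hle)
  have hae : ∀ᵐ u : ℝ, u ≠ 0 := by simp [ae_iff]
  rw [← lintegral_indicator measurableSet_Ioo, ← lintegral_indicator measurableSet_Ioo]
  refine lintegral_mono_ae ?_
  filter_upwards [hae] with u hu
  by_cases hu' : u ∈ Ioo (0 : ℝ) b
  · rw [indicator_of_mem hu']
    exact indicator_le_self _ _ u
  · rw [indicator_of_notMem hu', nonpos_iff_eq_zero]
    by_cases hst : u ∈ Ioo s t
    · rw [indicator_of_mem hst, h0 u, ENNReal.ofReal_zero]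
      intro hI
      exact hu' ⟨lt_of_le_of_ne hI.1 (Ne.symm hu), hst.2.trans_le (le_max_left _ _)⟩
    · exact indicator_of_notMem hst _

lemma locallyFinite_selfLoop : M.selfLoop.LocallyFinite := fun x s t ht => by
  refine ne_top_of_le_ne_top ?_ (lintegral_mono fun u => M.selfLoop_total_le u x)
  rw [lintegral_const_mul' _ _ (ENNReal.natCast_ne_top D)]
  exact ENNReal.mul_ne_top (ENNReal.natCast_ne_top D) (M.lintegral_noiseRate_ne_top s ht)

lemma coe_selfLoop_eventProb {t : ℝ} {x : Fin D → Fin S} (h : M.selfLoop.total t x ≠ 0)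
    (d : Fin D) (j : Fin S) :
    (M.selfLoop.eventProb t x (d, j) : ℝ)
      = M.planner t x d / (∑ d', M.planner t x d') * M.denoiser t x d j := by
  have h' : M.noiseRate t * ∑ d, M.planner t x d ≠ 0 := by
    rw [← coe_selfLoop_total]; exact_mod_cast h
  have h1 := left_ne_zero_of_mul h'
  have h2 := right_ne_zero_of_mul h'
  rw [JumpMechanism.eventProb, NNReal.coe_div, coe_selfLoop_rate, coe_selfLoop_total, jumpRate]
  field_simp

lemma sum_selfLoop_eventProb {t : ℝ} {x : Fin D → Fin S} (h : M.selfLoop.total t x ≠ 0)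
    (d : Fin D) : ∑ j, (M.selfLoop.eventProb t x (d, j) : ℝ)
      = M.planner t x d / ∑ d', M.planner t x d' := by
  simp_rw [M.coe_selfLoop_eventProb h]
  rw [← Finset.mul_sum, M.sum_denoiser, mul_one]

end PlannerDenoiser

end

theorem proposition2 {D S : ℕ} (M : PlannerDenoiser D S) (p₀ : PMF (Fin D → Fin S)) :
    -- same distribution over trajectories, from any common initial distribution
    M.ctmc.trajectoryLaw p₀ = M.selfLoop.trajectoryLaw p₀ ∧
    ∀ t ∈ Set.Ico (0 : ℝ) 1, ∀ x : Fin D → Fin S,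
      -- total jump rate of the self-loop process
      (M.selfLoop.total t x : ℝ)
        = derivWithin M.α (Set.Ico 0 1) t / (1 - M.α t) * ∑ d, M.planner t x d ∧
      (M.selfLoop.total t x ≠ 0 →
        -- the dimension is sampled proportionally to the planner
        (∀ d, ∑ j, (M.selfLoop.eventProb t x (d, j) : ℝ)
          = M.planner t x d / ∑ d', M.planner t x d') ∧
        -- given the dimension, the value is sampled from the denoiser
        (∀ d, ∑ j', (M.selfLoop.eventProb t x (d, j') : ℝ) ≠ 0 → ∀ j,
          (M.selfLoop.eventProb t x (d, j) : ℝ) / ∑ j', (M.selfLoop.eventProb t x (d, j') : ℝ)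
            = M.denoiser t x d j)) := by
  refine ⟨M.isSelfLoopExtension.trajectoryLaw_eq p₀ M.locallyFinite_selfLoop,
    fun t ht x => ⟨?_, fun h => ⟨M.sum_selfLoop_eventProb h, fun d hd j => ?_⟩⟩⟩
  · rw [M.coe_selfLoop_total, PlannerDenoiser.noiseRate, Set.indicator_of_mem ht]
  · rw [M.sum_selfLoop_eventProb h] at hd ⊢
    rw [M.coe_selfLoop_eventProb h, mul_div_cancel_left₀ _ hd]
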